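/- Let $K$ be a number field with ring of integers $\mathcal O_K$. Write $\mathfrak m$ for nonzero ideals of $\mathcal O_K$, $N(\mathfrak m)$ for the absolute norm of $\mathfrak m$, and $\Omega(\mathfrak m)$ for the number of prime ideals dividing $\mathfrak m$, counted with multiplicity. All asymptotics are as the real variable $x\to\infty$. (1) There is a positive integer $N$ such that for all integers $k_1,k_2\ge N$ and every $g:\mathbb N_0\to\mathbb C$ with $|g(n)|\le 1$ for all $n$, $$\sum_{N(\mathfrak m)\le x} g(\Omega(\mathfrak m)+k_1)=\sum_{N(\mathfrak m)\le x} g(\Omega(\mathfrak m)+k_2)+o\Big(\sum_{N(\mathfrak m)\le x}1\Big),$$ where, for fixed $K,k_1,k_2$, the error term is uniform in $g$: there is a function $E$ on $\mathbb R$, depending only on $K,k_1,k_2$, with $E(x)=o\big(\#\{\mathfrak m: N(\mathfrak m)\le x\}\big)$, such that for every such $g$ and every real $x$ the two sums differ in absolute value by at most $E(x)$. (2) $L(x):=\sum_{N(\mathfrak m)\le x}(-1)^{\Omega(\mathfrak m)}=o(x)$. (3) $\Omega$ is equidistributed modulo $q$ for every integer $q\ge 1$: for every integer $c\ge 0$,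 $$\frac{\#\{\mathfrak m: N(\mathfrak m)\le x,\ \Omega(\mathfrak m)\equiv c \pmod q\}}{\#\{\mathfrak m: N(\mathfrak m)\le x\}}\longrightarrow \frac1q .$$ (4) For every irrational real $\alpha$, $\Omega(\mathfrak m)\alpha$ is uniformly distributed modulo $1$: for all $0\le a\le b\le 1$, $$\frac{\#\{\mathfrak m: N(\mathfrak m)\le x,\ \{\Omega(\mathfrak m)\alpha\}\in[a,b)\}}{\#\{\mathfrak m: N(\mathfrak m)\le x\}}\longrightarrow b-a ,$$ where $\{t\}$ denotes the fractional part of $t$. -/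

import Mathlib

open scoped NumberField

/-- The nonzero integral ideals of `K` of norm at most `x` form a finite set. -/
theorem finite_idealsUpTo (K : Type*) [Field K] [NumberField K] (x : ℝ) :
    {I : Ideal (𝓞 K) | I ≠ ⊥ ∧ (Ideal.absNorm I : ℝ) ≤ x}.Finite :=
  (Ideal.finite_setOfPred_absNorm_le (S := 𝓞 K) ⌊x⌋₊).subset
    fun _ hI => Nat.le_floor hI.2

/-- The finite set of nonzero integral ideals `𝔪` of `K` with `N(𝔪) ≤ x`. -/
noncomputable def idealsUpTo (K : Type*) [Field K] [NumberField K] (x : ℝ) :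
    Finset (Ideal (𝓞 K)) :=
  (finite_idealsUpTo K x).toFinset

/-- `Ω(𝔪)`: the number of prime ideals dividing `𝔪`, counted with multiplicity. -/
noncomputable def idealOmega {K : Type*} [Field K] [NumberField K] (I : Ideal (𝓞 K)) : ℕ :=
  Multiset.card (UniqueFactorizationMonoid.normalizedFactors I)

/-- The proportion of the nonzero integral ideals `𝔪` of `K` with `N(𝔪) ≤ x` for which
`Ω(𝔪)` has the property `P`. -/
noncomputable def omegaProportion (K : Type*) [Field K] [NumberField K] (P : ℕ → Prop)
    (x : ℝ) : ℝ :=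
  open Classical in
  (((idealsUpTo K x).filter (fun I => P (idealOmega I))).card : ℝ) / ((idealsUpTo K x).card : ℝ)

/-!
# Equidistribution of the number of prime ideal factors

Fix `K`, and let `c > 0` be the density of its ideals, `#{N(𝔪) ≤ x} ∼ c x`. Everything follows from
one fact, `abs_sum_shift_sub_le`: the sums of `g (Ω(𝔪) + k₁)` and of `g (Ω(𝔪) + k₂)` over
`N(𝔪) ≤ x` differ by `o(x)`, uniformly in real `g` bounded by 1.

Suppose this fails along `x_i → ∞` and functions `g_i`. Let `F k u` be the limit along an
ultrafilter of the sums of `g_i (Ω(𝔪) + k)` over `N(𝔪) ≤ x_i e^u`, divided by `x_i e^u`. Since the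
ideals have a density, `F k` is Lipschitz. For a finite set `B` of primes with
`L = ∑_{𝔭 ∈ B} 1 / N(𝔭)`, the Turán–Kubilius inequality (`abs_sum_sum_sub_le`) becomes in the limit
`|∑_{𝔭 ∈ B} F (k + 1) (u - log N(𝔭)) / N(𝔭) - L * F k u| ≤ c √L`. As `B` is arbitrary, for given `k`
and `u` the values `F (k + 1) (u - log N(𝔭))` are close to `F k u` for all `𝔭` outside a *thin* set,
one over which the sum of `1 / N(𝔭)` converges (`isThin_of_abs_sum_sub_le`).

The arithmetic input on primes is `exists_primes_log_sub_mem_Icc`: outside any thin set there are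
primes `𝔭`, `𝔮` with `log N(𝔮) - log N(𝔭)` in `[δ, η]`, for arbitrarily small `η` and a `δ > 0`
independent of the thin set. Such differences are approximate periods of `F k`, so `F k` is
constant, and then `F (k + 1) = F k` (`eq_of_isThin`), a contradiction. If the statement on primes
failed, then almost all primes would lie, on the logarithmic scale, in intervals of length `δ`, one
in each window of length `η`. Selberg's symmetry formula over `ℤ` (`selberg_symmetry`) implies that
the rational primes, hence the prime ideals, have weight `O(δ)` in such an interval
(`exists_sum_log_div_le`), which for small `δ / η` contradicts the Chebyshev type lower bound
`∑_{N(𝔭) ≤ x} log N(𝔭) / N(𝔭) ≥ κ log x` (`exists_le_sum_log_primeNorm_div`). No information on the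
zeros of the Dedekind zeta function is used.

For the consequences, `g n = (-1) ^ n` changes sign under translation; the indicator functions of
the residue classes modulo `q` are translates of each other; and for irrational `α` the indicator
of an interval modulo 1 is its length plus a difference of two translates of a sawtooth function,
whose means agree asymptotically because the multiples of `α` are dense modulo 1.
-/

open IsDedekindDomain

/-! ### Selberg's symmetry formula and primes in short intervals -/

open Finset in
/-- Dirichlet's rearrangement: sums over pairs `(d, n)` with `d * n ≤ N`. -/
theorem sum_Ioc_sum_divisorsAntidiagonal (f : ℕ → ℕ → ℝ) (N : ℕ) :
    ∑ k ∈ Ioc 0 N, ∑ p ∈ k.divisorsAntidiagonal, f p.1 p.2 =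
      ∑ d ∈ Ioc 0 N, ∑ n ∈ Ioc 0 (N / d), f d n := by
  trans ∑ k ∈ Ioc 0 N, ∑ x ∈ Ioc 0 N ×ˢ Ioc 0 N with x.1 * x.2 = k, f x.1 x.2
  · refine sum_congr rfl fun n hn ↦ ?_
    simp only [mem_Ioc] at hn
    rw [Nat.divisorsAntidiagonal_eq_prod_filter_of_le hn.1.ne' hn.2]
  trans ∑ x ∈ Ioc 0 N ×ˢ Ioc 0 N with x.1 * x.2 ≤ N, f x.1 x.2
  · simp_rw [sum_filter]
    rw [sum_comm]
    refine sum_congr rfl fun x hx ↦ ?_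
    simp only [mem_product, mem_Ioc] at hx
    have := Nat.mul_pos hx.1.1 hx.2.1
    by_cases h : x.1 * x.2 ≤ N
    · simp [h, this]
    · simp [h]
  · rw [sum_filter, sum_product]
    refine sum_congr rfl fun d hd ↦ ?_
    rw [← sum_filter]
    refine sum_congr ?_ fun _ _ ↦ rfl
    ext n
    simp only [mem_filter, mem_Ioc] at hd ⊢
    rw [Nat.le_div_iff_mul_le hd.1, mul_comm n d]
    refine ⟨fun h ↦ ⟨h.1.1, h.2⟩, fun h ↦ ⟨⟨h.1, ?_⟩, h.2⟩⟩
    exact le_trans (Nat.le_mul_of_pos_left n hd.1) h.2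

theorem mul_log_sub_le_log_factorial {n : ℕ} (hn : 0 < n) :
    n * Real.log n - n ≤ Real.log n.factorial := by
  have h := Real.pow_div_factorial_le_exp (x := n) (by positivity) n
  rw [div_le_iff₀ (by positivity)] at h
  have hn' : (0 : ℝ) < n := by exact_mod_cast hn
  have := Real.log_le_log (by positivity) h
  rw [Real.log_mul (by positivity) (by positivity), Real.log_exp, Real.log_pow] at this
  linarith

theorem log_factorial_le {n : ℕ} (hn : 0 < n) :
    Real.log n.factorial ≤ n * Real.log n - n + 1 + Real.log n := by
  induction n, hn using Nat.le_induction with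
  | base => simp
  | succ n hn ih =>
    have hn' : (0 : ℝ) < n := by exact_mod_cast hn
    rw [Nat.factorial_succ, Nat.cast_mul, Real.log_mul (by positivity) (by positivity)]
    have h := Real.one_sub_inv_le_log_of_pos (x := (n + 1) / n) (by positivity)
    rw [Real.log_div (by positivity) (by positivity)] at h
    have h2 : ((n : ℝ) + 1) * (1 - ((n + 1) / n : ℝ)⁻¹) = 1 := by field_simp; ring
    have h3 := mul_le_mul_of_nonneg_left h (by positivity : (0 : ℝ) ≤ n + 1)
    rw [h2] at h3
    push_cast
    linarith

open Finset ArithmeticFunction in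
theorem sum_Ioc_log (N : ℕ) : ∑ n ∈ Ioc 0 N, Real.log n = Real.log N.factorial := by
  induction N with
  | zero => simp
  | succ N ih =>
    rw [← Finset.insert_Ioc_right_eq_Ioc_add_one (by omega), Finset.sum_insert (by simp), ih,
      Nat.factorial_succ, Nat.cast_mul, Real.log_mul (by positivity) (by positivity)]

open Finset ArithmeticFunction in
theorem sum_psi_div (y : ℝ) :
    ∑ n ∈ Ioc 0 ⌊y⌋₊, Chebyshev.psi (y / n) = Real.log (⌊y⌋₊.factorial) := by
  have h := sum_Ioc_sum_divisorsAntidiagonal (fun _ m => vonMangoldt m) ⌊y⌋₊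
  simp only [Chebyshev.psi, Nat.floor_div_natCast]
  rw [← h, ← sum_Ioc_log]
  refine sum_congr rfl fun k _ ↦ ?_
  rw [Nat.sum_divisorsAntidiagonal' (fun _ m => vonMangoldt m), vonMangoldt_sum]

open Real in
/-- Summing `ψ(y / n) - y / n + γ + 1` over `n ≤ y` cancels the terms of order `y log y` and `y`:
the constant `γ + 1` is what makes the remainder logarithmic. -/
theorem abs_sum_psi_sub_le {y : ℝ} (hy : 1 ≤ y) :
    |∑ n ∈ Finset.Ioc 0 ⌊y⌋₊, (Chebyshev.psi (y / n) - y / n + (eulerMascheroniConstant + 1))|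
      ≤ 4 + 2 * log y := by
  set M := ⌊y⌋₊ with hM
  have hM1 : 1 ≤ M := Nat.one_le_floor_iff _ |>.2 hy
  have hM1' : (1 : ℝ) ≤ M := by exact_mod_cast hM1
  have hMy : (M : ℝ) ≤ y := Nat.floor_le (by linarith)
  have hyM : y < M + 1 := Nat.lt_floor_add_one y
  have hH : ∑ n ∈ Finset.Ioc 0 M, y / (n : ℝ) = y * (harmonic M : ℝ) := by
    rw [harmonic_eq_sum_Icc]
    push_cast
    rw [Finset.mul_sum]
    rfl
  rw [Finset.sum_add_distrib, Finset.sum_sub_distrib, sum_psi_div, hH]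
  simp only [Finset.sum_const, Nat.card_Ioc, nsmul_eq_mul, Nat.sub_zero, ← hM]
  have h1 := mul_log_sub_le_log_factorial hM1
  have h2 := log_factorial_le hM1
  have h3 := eulerMascheroniSeq_lt_eulerMascheroniConstant M
  have h4 := eulerMascheroniConstant_lt_eulerMascheroniSeq' M
  rw [eulerMascheroniSeq] at h3
  rw [eulerMascheroniSeq', if_neg (by omega)] at h4
  have h5 := one_half_lt_eulerMascheroniConstant
  have h6 := eulerMascheroniConstant_lt_two_thirds
  have h7 : log (M + 1) - log M ≤ 1 / M := by
    rw [← log_div (by positivity) (by positivity)]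
    have := log_le_sub_one_of_pos (x := ((M : ℝ) + 1) / M) (by positivity)
    have e : ((M : ℝ) + 1) / M - 1 = 1 / M := by field_simp; ring
    linarith
  have hl : log M ≤ log y := log_le_log (by positivity) hMy
  have hl0 : 0 ≤ log M := log_nonneg hM1'
  set H : ℝ := (harmonic M : ℝ)
  set γ := eulerMascheroniConstant
  have hd0 : 0 ≤ H - log M - γ := by linarith
  have hd1 : y * (H - log M - γ) ≤ 2 := by
    have : H - log M - γ ≤ 1 / M := by linarith
    calc y * (H - log M - γ) ≤ (2 * M) * (1 / M) := by gcongr; linarith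
      _ = 2 := by field_simp
  have hd2 : 0 ≤ y * (H - log M - γ) := by positivity
  have hd3 : 0 ≤ (y - M) * log M := mul_nonneg (by linarith) hl0
  have hd4 : (y - M) * log M ≤ 1 * log M := by gcongr; linarith
  have hd5 : 0 ≤ (y - M) * γ := mul_nonneg (by linarith) (by linarith)
  have hd6 : (y - M) * γ ≤ 1 * 1 := by gcongr <;> linarith
  rw [abs_le]
  constructor <;> nlinarith

theorem sum_inv_sqrt_le (N : ℕ) : ∑ d ∈ Finset.Ioc 0 N, 1 / √(d : ℝ) ≤ 2 * √N := by
  induction N with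
  | zero => simp
  | succ N ih =>
    rw [← Finset.insert_Ioc_right_eq_Ioc_add_one (by omega), Finset.sum_insert (by simp)]
    have h1 : (0 : ℝ) < √((N + 1 : ℕ) : ℝ) := by positivity
    have h2 : √((N + 1 : ℕ) : ℝ) ^ 2 = N + 1 := by
      rw [Real.sq_sqrt (by positivity)]; push_cast; ring
    have h3 : √(N : ℝ) ^ 2 = N := Real.sq_sqrt (by positivity)
    have h4 : √(N : ℝ) ≤ √((N + 1 : ℕ) : ℝ) := Real.sqrt_le_sqrt (by push_cast; linarith)
    have : 1 / √((N + 1 : ℕ) : ℝ) ≤ 2 * (√((N + 1 : ℕ) : ℝ) - √N) := by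
      rw [div_le_iff₀ h1]
      nlinarith [sq_nonneg (√((N + 1 : ℕ) : ℝ) - √N)]
    linarith

theorem log_mul_le_sqrt {y : ℝ} (hy : 1 ≤ y) : Real.log y * (4 + 2 * Real.log y) ≤ 48 * √y := by
  set s := √√y
  have hs : 1 ≤ s := Real.one_le_sqrt.2 (Real.one_le_sqrt.2 hy)
  have h2 : s ^ 2 = √y := Real.sq_sqrt (by positivity)
  have h4 : s ^ 4 = y := by
    rw [show s ^ 4 = (s ^ 2) ^ 2 by ring, h2, Real.sq_sqrt (by linarith)]
  have hl : Real.log y ≤ 4 * s := by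
    rw [← h4, Real.log_pow]
    have := Real.log_le_self (by linarith : 0 ≤ s)
    push_cast; linarith
  have hl0 := Real.log_nonneg hy
  rw [← h2]
  nlinarith

open Finset ArithmeticFunction in
/-- The Tatuzawa–Iseki identity: Möbius inversion weighted by `log (N / d)`, in which
`∑_{d ∣ k} μ(d) log (N / d) = [k = 1] log N + Λ(k)`. -/
theorem sum_moebius_mul_log_mul_sum (F : ℝ → ℝ) {N : ℕ} (hN : 0 < N) :
    ∑ d ∈ Ioc 0 N, (moebius d : ℝ) * Real.log ((N : ℝ) / d) *
        ∑ n ∈ Ioc 0 (N / d), F ((N : ℝ) / d / n) =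
      F N * Real.log N + ∑ k ∈ Ioc 0 N, vonMangoldt k * F ((N : ℝ) / k) := by
  simp_rw [mul_sum]
  rw [← sum_Ioc_sum_divisorsAntidiagonal (fun d n =>
    (moebius d : ℝ) * Real.log ((N : ℝ) / d) * F ((N : ℝ) / d / n))]
  have hk : ∀ k ∈ Ioc 0 N, ∑ p ∈ k.divisorsAntidiagonal,
      (moebius p.1 : ℝ) * Real.log ((N : ℝ) / p.1) * F ((N : ℝ) / p.1 / p.2) =
      (if k = 1 then Real.log N * F ((N : ℝ) / k) else 0) + vonMangoldt k * F ((N : ℝ) / k) := by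
    intro k hk
    have hk0 : k ≠ 0 := by simp at hk; omega
    have : ∀ p ∈ k.divisorsAntidiagonal,
        (moebius p.1 : ℝ) * Real.log ((N : ℝ) / p.1) * F ((N : ℝ) / p.1 / p.2) =
        (Real.log N * (moebius p.1 : ℝ) - (moebius p.1 : ℝ) * Real.log p.1) * F ((N : ℝ) / k) := by
      intro p hp
      rw [Nat.mem_divisorsAntidiagonal] at hp
      have h1 : (p.1 : ℝ) ≠ 0 := by
        have : p.1 ≠ 0 := by rintro h; simp [h] at hp; omega
        exact_mod_cast this
      rw [Real.log_div (by positivity) h1, div_div, ← Nat.cast_mul, hp.1]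
      ring
    rw [sum_congr rfl this, ← sum_mul, sum_sub_distrib, ← mul_sum,
      Nat.sum_divisorsAntidiagonal (fun i _ => (moebius i : ℝ)),
      Nat.sum_divisorsAntidiagonal (fun i _ => (moebius i : ℝ) * Real.log i)]
    have h1 := sum_moebius_mul_log_eq (n := k)
    simp only [log_apply] at h1
    have h2 : ∑ i ∈ k.divisors, (moebius i : ℝ) = if k = 1 then 1 else 0 := by
      have := congrArg (fun f : ArithmeticFunction ℤ => f k) moebius_mul_coe_zeta
      simp only [one_apply] at this
      rw [← Int.cast_sum]
      rw [coe_mul_zeta_apply] at this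
      rw [this]; split_ifs <;> simp
    rw [h1, h2]
    split_ifs <;> ring
  rw [sum_congr rfl hk, sum_add_distrib]
  congr 1
  rw [sum_ite_eq' , if_pos (by simp; omega)]
  simp [mul_comm]

theorem psi_le_six_mul {x : ℝ} (hx : 0 ≤ x) : Chebyshev.psi x ≤ 6 * x := by
  have h := Chebyshev.psi_le_const_mul_self hx
  have : Real.log 4 ≤ 2 := by
    rw [show (4 : ℝ) = 2 ^ 2 by norm_num, Real.log_pow]
    have := Real.log_two_lt_d9
    push_cast; linarith
  nlinarith

open Finset ArithmeticFunction in
/-- Mertens' first theorem, multiplied by `N`. -/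
theorem abs_sum_vonMangoldt_div_sub_le {N : ℕ} (hN : 0 < N) :
    |(∑ k ∈ Ioc 0 N, vonMangoldt k * ((N : ℝ) / k)) - N * Real.log N| ≤ 7 * N := by
  have hN1 : (1 : ℝ) ≤ N := by exact_mod_cast hN
  have h0 : ∑ k ∈ Ioc 0 N, vonMangoldt k * ((N / k : ℕ) : ℝ) = Real.log N.factorial := by
    rw [← sum_Ioc_log, ← sum_Ioc_mul_zeta_eq_sum]
    refine sum_congr rfl fun k _ ↦ ?_
    rw [vonMangoldt_mul_zeta, log_apply]
  have h1 : Real.log N.factorial ≤ ∑ k ∈ Ioc 0 N, vonMangoldt k * ((N : ℝ) / k) := by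
    rw [← h0]
    exact sum_le_sum fun k _ ↦ mul_le_mul_of_nonneg_left Nat.cast_div_le vonMangoldt_nonneg
  have h2 : ∑ k ∈ Ioc 0 N, vonMangoldt k * ((N : ℝ) / k) ≤
      Real.log N.factorial + Chebyshev.psi N := by
    rw [← h0, Chebyshev.psi, Nat.floor_natCast, ← sum_add_distrib]
    refine sum_le_sum fun k _ ↦ ?_
    rw [← mul_add_one]
    refine mul_le_mul_of_nonneg_left ?_ vonMangoldt_nonneg
    rw [← Nat.floor_div_eq_div (K := ℝ)]
    exact (Nat.lt_floor_add_one _).le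
  have h3 := psi_le_six_mul (x := N) (by positivity)
  have h4 := mul_log_sub_le_log_factorial hN
  have h5 := log_factorial_le hN
  have h6 := Real.log_le_sub_one_of_pos (x := N) (by positivity)
  rw [abs_le]
  constructor <;> linarith

open Finset ArithmeticFunction Real in
/-- Selberg's symmetry formula, from the Tatuzawa–Iseki identity with
`F(y) = ψ(y) - y + γ + 1`. -/
theorem selberg_symmetry {N : ℕ} (hN : 0 < N) :
    |Chebyshev.psi N * Real.log N +
      ∑ k ∈ Ioc 0 N, vonMangoldt k * Chebyshev.psi ((N : ℝ) / k) - 2 * (N * Real.log N)|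
      ≤ 120 * N := by
  have hN1 : (1 : ℝ) ≤ N := by exact_mod_cast hN
  have hid := sum_moebius_mul_log_mul_sum
    (fun y => Chebyshev.psi y - y + (eulerMascheroniConstant + 1)) hN
  have hb : |∑ d ∈ Ioc 0 N, (moebius d : ℝ) * Real.log ((N : ℝ) / d) *
      ∑ n ∈ Ioc 0 (N / d), (Chebyshev.psi ((N : ℝ) / d / n) - (N : ℝ) / d / n +
        (eulerMascheroniConstant + 1))| ≤ 96 * N := by
    calc _ ≤ ∑ d ∈ Ioc 0 N, 48 * √(N : ℝ) * (1 / √(d : ℝ)) := by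
          refine (abs_sum_le_sum_abs _ _).trans (sum_le_sum fun d hd ↦ ?_)
          rw [mem_Ioc] at hd
          have hd0 : (0 : ℝ) < d := by exact_mod_cast hd.1
          have hy : (1 : ℝ) ≤ (N : ℝ) / d := by
            rw [le_div_iff₀ hd0, one_mul]; exact_mod_cast hd.2
          have hG := abs_sum_psi_sub_le hy
          rw [Nat.floor_div_eq_div] at hG
          rw [abs_mul, abs_mul, abs_of_nonneg (Real.log_nonneg hy)]
          have hmu : |(moebius d : ℝ)| ≤ 1 := by exact_mod_cast abs_moebius_le_one (n := d)
          calc _ ≤ 1 * Real.log ((N : ℝ) / d) * (4 + 2 * Real.log ((N : ℝ) / d)) := by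
                gcongr
                · exact mul_nonneg zero_le_one (Real.log_nonneg hy)
                · exact Real.log_nonneg hy
            _ ≤ 48 * √((N : ℝ) / d) := by rw [one_mul]; exact log_mul_le_sqrt hy
            _ = _ := by rw [Real.sqrt_div (by positivity)]; ring
      _ ≤ 48 * √(N : ℝ) * (2 * √(N : ℝ)) := by
          rw [← mul_sum]; gcongr; exact sum_inv_sqrt_le N
      _ = 96 * (√(N : ℝ) * √(N : ℝ)) := by ring
      _ = 96 * N := by rw [Real.mul_self_sqrt (by positivity)]
  rw [hid] at hb
  have hpsi : ∑ k ∈ Ioc 0 N, vonMangoldt k = Chebyshev.psi N := by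
    rw [Chebyshev.psi, Nat.floor_natCast]
  simp only [mul_add, mul_sub, sum_add_distrib, sum_sub_distrib, ← sum_mul, mul_one, hpsi] at hb
  have h1 := abs_sum_vonMangoldt_div_sub_le hN
  have h3 := psi_le_six_mul (x := N) (by positivity)
  have h3' := Chebyshev.psi_nonneg N
  have h5 := one_half_lt_eulerMascheroniConstant
  have h6 := eulerMascheroniConstant_lt_two_thirds
  have h7 := Real.log_le_sub_one_of_pos (x := N) (by positivity)
  have h8 := Real.log_nonneg hN1
  rw [abs_le] at *
  constructor <;> nlinarith

open Finset ArithmeticFunction Real in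
/-- A Brun–Titchmarsh type inequality. Both terms of Selberg's formula increase with `N`, so the
first one grows by at most the growth of `2 N log N`, up to `O(N)`. -/
theorem psi_sub_psi_mul_log_le {N M : ℕ} (hN : 0 < N) (hNM : N ≤ M) (hM : M ≤ 3 * N) :
    (Chebyshev.psi M - Chebyshev.psi N) * Real.log N ≤ 2 * (M - N) * Real.log N + 500 * N := by
  have hN1 : (1 : ℝ) ≤ N := by exact_mod_cast hN
  have hNM' : (N : ℝ) ≤ M := by exact_mod_cast hNM
  have hM' : (M : ℝ) ≤ 3 * N := by exact_mod_cast hM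
  have h1 := (abs_le.1 (selberg_symmetry hN)).1
  have h2 := (abs_le.1 (selberg_symmetry (hN.trans_le hNM))).2
  have h3 : ∑ k ∈ Ioc 0 N, vonMangoldt k * Chebyshev.psi ((N : ℝ) / k) ≤
      ∑ k ∈ Ioc 0 M, vonMangoldt k * Chebyshev.psi ((M : ℝ) / k) := by
    calc _ ≤ ∑ k ∈ Ioc 0 N, vonMangoldt k * Chebyshev.psi ((M : ℝ) / k) := by
          refine sum_le_sum fun k _ ↦ mul_le_mul_of_nonneg_left ?_ vonMangoldt_nonneg
          exact Chebyshev.psi_mono (by gcongr)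
      _ ≤ _ := by
          refine sum_le_sum_of_subset_of_nonneg (Ioc_subset_Ioc_right hNM) fun k _ _ ↦ ?_
          exact mul_nonneg vonMangoldt_nonneg (Chebyshev.psi_nonneg _)
  have h4 : Real.log N ≤ Real.log M := Real.log_le_log (by linarith) hNM'
  have h5 : Real.log M ≤ Real.log N + 2 := by
    have : Real.log M ≤ Real.log (3 * N) := Real.log_le_log (by linarith) hM'
    rw [Real.log_mul (by norm_num) (by positivity)] at this
    have h3 := Real.log_le_sub_one_of_pos (x := 3) (by norm_num)
    linarith
  have h6 := mul_le_mul_of_nonneg_left h4 (Chebyshev.psi_nonneg M)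
  have h7 := mul_le_mul_of_nonneg_left h5 (by linarith : (0 : ℝ) ≤ M)
  linarith

open Finset ArithmeticFunction Real in
/-- Primes do not concentrate in short intervals: their logarithmic weight in an interval of
logarithmic length `δ` is eventually at most `5 * δ`. -/
theorem exists_sum_log_div_le {δ : ℝ} (hδ : 0 < δ) (hδ1 : δ ≤ 1 / 2) :
    ∃ V₀ : ℝ, ∀ V ≥ V₀, ∀ s : Finset ℕ, (∀ p ∈ s, p.Prime) →
      (∀ p ∈ s, V ≤ Real.log p ∧ Real.log p ≤ V + δ) →
      ∑ p ∈ s, Real.log p / p ≤ 5 * δ := by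
  refine ⟨2000 / δ + 10, fun V hV s hs hsV ↦ ?_⟩
  have hδV : 0 < 2000 / δ := by positivity
  have hV0 : 10 < V := by linarith
  set y := Real.exp V with hy
  have hyV : V + 1 ≤ y := Real.add_one_le_exp V
  have hy0 : 0 < y := Real.exp_pos V
  -- Subtracting one puts a prime equal to `y` inside the half-open interval `(N, M]`.
  set N := ⌈y⌉₊ - 1 with hNdef
  set M := ⌊y * Real.exp δ⌋₊ with hMdef
  have hc1 : 2 ≤ ⌈y⌉₊ := by
    have : y ≤ ⌈y⌉₊ := Nat.le_ceil y
    have : (2 : ℝ) ≤ (⌈y⌉₊ : ℝ) := by linarith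
    exact_mod_cast this
  have hN : 0 < N := by omega
  have hNc : (N : ℝ) = ⌈y⌉₊ - 1 := by rw [hNdef, Nat.cast_sub (by omega)]; simp
  have hNy : (N : ℝ) ≤ y := by rw [hNc]; have := Nat.ceil_lt_add_one hy0.le; linarith
  have hyN : y - 1 ≤ N := by rw [hNc]; have := Nat.le_ceil y; linarith
  have he : Real.exp δ ≤ 1 + 2 * δ := by
    have := Real.abs_exp_sub_one_le (x := δ) (by rw [abs_of_pos hδ]; linarith)
    rw [abs_of_pos hδ] at this
    have := (abs_le.1 this).2
    linarith
  have he1 : 1 ≤ Real.exp δ := Real.one_le_exp hδ.le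
  have hMy : (M : ℝ) ≤ y * (1 + 2 * δ) := by
    have : (M : ℝ) ≤ y * Real.exp δ := Nat.floor_le (by positivity)
    nlinarith
  have hyM : y - 1 < M := by
    have := Nat.lt_floor_add_one (y * Real.exp δ)
    nlinarith
  have hNM : N ≤ M := by
    have h1 : (N : ℝ) < M + 1 := by linarith
    have : N < M + 1 := by exact_mod_cast h1
    omega
  have hsub : s ⊆ Ioc N M := by
    intro p hp
    have hp0 : (0 : ℝ) < p := by exact_mod_cast (hs p hp).pos
    have h1 : y ≤ p := by rw [hy, ← Real.le_log_iff_exp_le hp0]; exact (hsV p hp).1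
    have h2 : (p : ℝ) ≤ y * Real.exp δ := by
      rw [hy, ← Real.exp_add, ← Real.log_le_iff_le_exp hp0]; exact (hsV p hp).2
    have h3 : ⌈y⌉₊ ≤ p := Nat.ceil_le.2 h1
    have h4 : p ≤ M := Nat.le_floor h2
    simp only [mem_Ioc]; omega
  have hM3 : M ≤ 3 * N := by
    have h1 : (M : ℝ) ≤ 3 * N := by nlinarith
    exact_mod_cast h1
  have hBT := psi_sub_psi_mul_log_le hN hNM hM3
  have hsum : ∑ p ∈ s, Real.log p / p ≤ (Chebyshev.psi M - Chebyshev.psi N) / y := by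
    have e : Chebyshev.psi M - Chebyshev.psi N = ∑ n ∈ Ioc N M, vonMangoldt n := by
      simp only [Chebyshev.psi, Nat.floor_natCast]
      rw [sub_eq_iff_eq_add, add_comm, sum_Ioc_consecutive _ (Nat.zero_le _) hNM]
    rw [e, sum_div]
    calc _ ≤ ∑ p ∈ s, vonMangoldt p / y := by
          refine sum_le_sum fun p hp ↦ ?_
          have hp0 : (0 : ℝ) < p := by exact_mod_cast (hs p hp).pos
          rw [vonMangoldt_apply_prime (hs p hp)]
          have h1 : y ≤ p := by rw [hy, ← Real.le_log_iff_exp_le hp0]; exact (hsV p hp).1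
          have := Real.log_nonneg (x := p) (by exact_mod_cast (hs p hp).one_lt.le)
          gcongr
      _ ≤ _ := sum_le_sum_of_subset_of_nonneg hsub fun p _ _ ↦
          div_nonneg vonMangoldt_nonneg hy0.le
  refine hsum.trans ?_
  rw [div_le_iff₀ hy0]
  have hlogN : V - 1 ≤ Real.log N := by
    rw [Real.le_log_iff_exp_le (by exact_mod_cast hN), Real.exp_sub]
    have : Real.exp 1 ≥ 2 := by have := Real.add_one_le_exp (1 : ℝ); linarith
    calc _ ≤ y / 2 := by gcongr
      _ ≤ N := by linarith
  have hL : 2000 / δ ≤ Real.log N := by linarith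
  have hLpos : 0 < Real.log N := by linarith
  have h500 : 500 * N ≤ (δ / 4 * y) * Real.log N := by
    have : δ / 4 * (2000 / δ) = 500 := by field_simp; norm_num
    have h2 := mul_le_mul_of_nonneg_left hL (by positivity : 0 ≤ δ / 4 * y)
    nlinarith
  have h6 : Chebyshev.psi M - Chebyshev.psi N ≤ 2 * (M - N) + δ / 4 * y := by
    refine le_of_mul_le_mul_right ?_ hLpos
    nlinarith
  have h7 : 2000 ≤ δ * y := by
    have : 2000 / δ ≤ y := by linarith
    rw [div_le_iff₀ hδ] at this; linarith
  nlinarith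

/-! ### Counting ideals and the Turán–Kubilius inequality -/

theorem mem_idealsUpTo {K : Type*} [Field K] [NumberField K] {x : ℝ} {I : Ideal (𝓞 K)} :
    I ∈ idealsUpTo K x ↔ I ≠ ⊥ ∧ (Ideal.absNorm I : ℝ) ≤ x := by
  simp [idealsUpTo]

theorem idealsUpTo_mono (K : Type*) [Field K] [NumberField K] {x y : ℝ} (h : x ≤ y) :
    idealsUpTo K x ⊆ idealsUpTo K y := fun I hI ↦ by
  rw [mem_idealsUpTo] at hI ⊢
  exact ⟨hI.1, hI.2.trans h⟩

open Filter Topology in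
/-- The ideals of a number field have positive density with respect to the norm. -/
theorem exists_tendsto_card_idealsUpTo_div (K : Type*) [Field K] [NumberField K] :
    ∃ c : ℝ, 0 < c ∧ Tendsto (fun x : ℝ ↦ ((idealsUpTo K x).card : ℝ) / x) atTop (𝓝 c) := by
  refine ⟨_, ?_, (NumberField.Ideal.tendsto_norm_le_div_atTop₀ K).congr fun x ↦ ?_⟩
  · have h1 := NumberField.Units.regulator_pos K
    have h2 : 0 < (NumberField.classNumber K : ℝ) := by
      exact_mod_cast NumberField.classNumber_pos K
    have h3 : 0 < (NumberField.Units.torsionOrder K : ℝ) := by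
      exact_mod_cast NumberField.Units.torsionOrder_pos K
    have h4 : (0 : ℝ) < |(NumberField.discr K : ℝ)| := by
      rw [abs_pos]; exact_mod_cast NumberField.discr_ne_zero K
    positivity
  · congr 2
    rw [← Nat.card_eq_finsetCard]
    exact Nat.card_congr
      { toFun := fun I ↦ ⟨I.1.1, mem_idealsUpTo.2 ⟨nonZeroDivisors.coe_ne_zero I.1, I.2⟩⟩
        invFun := fun I ↦ ⟨⟨I.1, mem_nonZeroDivisors_of_ne_zero (mem_idealsUpTo.1 I.2).1⟩,
          (mem_idealsUpTo.1 I.2).2⟩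
        left_inv := fun _ ↦ rfl
        right_inv := fun _ ↦ rfl }

/-- Ideals of norm at most `x` divisible by `A` are the products `A * J` with
`N(J) ≤ x / N(A)`. -/
theorem sum_idealsUpTo_filter_dvd {K : Type*} [Field K] [NumberField K] {A : Ideal (𝓞 K)}
    (hA : A ≠ ⊥) [DecidablePred (A ∣ ·)] (f : Ideal (𝓞 K) → ℝ) (x : ℝ) :
    ∑ I ∈ idealsUpTo K x with A ∣ I, f I =
      ∑ J ∈ idealsUpTo K (x / (Ideal.absNorm A : ℝ)), f (A * J) := by
  have hA0 : (0 : ℝ) < Ideal.absNorm A := by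
    rw [Nat.cast_pos, Nat.pos_iff_ne_zero, Ne, Ideal.absNorm_eq_zero_iff]; exact hA
  symm
  refine Finset.sum_bij (fun J _ ↦ A * J) ?_ ?_ ?_ (fun _ _ ↦ rfl)
  · intro J hJ
    rw [mem_idealsUpTo, le_div_iff₀ hA0] at hJ
    rw [Finset.mem_filter, mem_idealsUpTo, map_mul, Nat.cast_mul, mul_comm (Ideal.absNorm A : ℝ)]
    exact ⟨⟨mul_ne_zero hA hJ.1, hJ.2⟩, dvd_mul_right _ _⟩
  · intro J _ J' _ h
    exact mul_left_cancel₀ hA h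
  · intro I hI
    rw [Finset.mem_filter, mem_idealsUpTo] at hI
    obtain ⟨⟨h0, hx⟩, J, rfl⟩ := hI
    refine ⟨J, ?_, rfl⟩
    rw [mem_idealsUpTo, le_div_iff₀ hA0]
    rw [map_mul, Nat.cast_mul, mul_comm (Ideal.absNorm A : ℝ)] at hx
    exact ⟨right_ne_zero_of_mul h0, hx⟩

theorem idealOmega_mul_prime {K : Type*} [Field K] [NumberField K]
    (v : HeightOneSpectrum (𝓞 K)) {J : Ideal (𝓞 K)} (hJ : J ≠ ⊥) :
    idealOmega (v.asIdeal * J) = idealOmega J + 1 := by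
  rw [idealOmega, idealOmega, UniqueFactorizationMonoid.normalizedFactors_mul v.ne_bot hJ,
    UniqueFactorizationMonoid.normalizedFactors_irreducible v.irreducible, Multiset.card_add,
    Multiset.card_singleton, add_comm]

/-- The absolute norm of a nonzero prime ideal, as a real number. -/
noncomputable def primeNorm {K : Type*} [Field K] [NumberField K]
    (v : HeightOneSpectrum (𝓞 K)) : ℝ :=
  (Ideal.absNorm v.asIdeal : ℝ)

theorem two_le_absNorm {K : Type*} [Field K] [NumberField K]
    (v : HeightOneSpectrum (𝓞 K)) : 2 ≤ Ideal.absNorm v.asIdeal := by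
  have h0 : Ideal.absNorm v.asIdeal ≠ 0 := by
    rw [Ne, Ideal.absNorm_eq_zero_iff]; exact v.ne_bot
  have h1 : Ideal.absNorm v.asIdeal ≠ 1 := by
    rw [Ne, Ideal.absNorm_eq_one_iff]; exact v.isPrime.ne_top
  omega

theorem two_le_primeNorm {K : Type*} [Field K] [NumberField K]
    (v : HeightOneSpectrum (𝓞 K)) : 2 ≤ primeNorm v := by
  unfold primeNorm; exact_mod_cast two_le_absNorm v

theorem primeNorm_pos {K : Type*} [Field K] [NumberField K]
    (v : HeightOneSpectrum (𝓞 K)) : 0 < primeNorm v :=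
  zero_lt_two.trans_le (two_le_primeNorm v)

theorem dvd_and_dvd_iff_mul_dvd {K : Type*} [Field K] [NumberField K]
    {v w : HeightOneSpectrum (𝓞 K)} (h : v ≠ w) (I : Ideal (𝓞 K)) :
    (v.asIdeal ∣ I ∧ w.asIdeal ∣ I) ↔ v.asIdeal * w.asIdeal ∣ I :=
  ⟨fun hI ↦ (HeightOneSpectrum.isCoprime_of_ne v w h).mul_dvd hI.1 hI.2,
    fun hI ↦ ⟨dvd_of_mul_right_dvd hI, dvd_of_mul_left_dvd hI⟩⟩

/-- The sum of `1 / N(𝔭)` over a finite set of primes. -/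
noncomputable def invNormSum {K : Type*} [Field K] [NumberField K]
    (B : Finset (HeightOneSpectrum (𝓞 K))) : ℝ :=
  ∑ v ∈ B, 1 / primeNorm v

open Classical in
/-- The second moment, over the ideals of norm at most `x`, of
`#{𝔭 ∈ B : 𝔭 ∣ 𝔪} - ∑_{𝔭 ∈ B} 1 / N(𝔭)`, expanded in terms of the counting function. -/
noncomputable def turanKubiliusMoment {K : Type*} [Field K] [NumberField K]
    (B : Finset (HeightOneSpectrum (𝓞 K))) (x : ℝ) : ℝ :=
  (∑ v ∈ B, ∑ w ∈ B, if v = w then ((idealsUpTo K (x / primeNorm v)).card : ℝ)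
    else ((idealsUpTo K (x / (primeNorm v * primeNorm w))).card : ℝ)) -
  2 * invNormSum B * (∑ v ∈ B, ((idealsUpTo K (x / primeNorm v)).card : ℝ)) +
  invNormSum B ^ 2 * ((idealsUpTo K x).card : ℝ)

open Classical in
theorem sum_sq_count_sub {K : Type*} [Field K] [NumberField K]
    (B : Finset (HeightOneSpectrum (𝓞 K))) (x : ℝ) :
    ∑ I ∈ idealsUpTo K x,
      ((∑ v ∈ B, if v.asIdeal ∣ I then (1 : ℝ) else 0) - invNormSum B) ^ 2 =
      turanKubiliusMoment B x := by
  have hcard : ∀ A : Ideal (𝓞 K), A ≠ ⊥ →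
      ∑ I ∈ idealsUpTo K x, (if A ∣ I then (1 : ℝ) else 0) =
        ((idealsUpTo K (x / (Ideal.absNorm A : ℝ))).card : ℝ) := by
    intro A hA
    rw [← Finset.sum_filter, sum_idealsUpTo_filter_dvd hA]
    simp
  have hsq : ∑ I ∈ idealsUpTo K x, (∑ v ∈ B, if v.asIdeal ∣ I then (1 : ℝ) else 0) ^ 2 =
      ∑ v ∈ B, ∑ w ∈ B, if v = w then ((idealsUpTo K (x / primeNorm v)).card : ℝ)
        else ((idealsUpTo K (x / (primeNorm v * primeNorm w))).card : ℝ) := by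
    simp_rw [sq, Finset.sum_mul_sum]
    rw [Finset.sum_comm]
    refine Finset.sum_congr rfl fun v _ ↦ ?_
    rw [Finset.sum_comm]
    refine Finset.sum_congr rfl fun w _ ↦ ?_
    split_ifs with h
    · subst h
      rw [primeNorm, ← hcard _ v.ne_bot]
      refine Finset.sum_congr rfl fun I _ ↦ ?_
      split_ifs <;> simp
    · rw [primeNorm, primeNorm, ← Nat.cast_mul, ← map_mul,
        ← hcard _ (mul_ne_zero v.ne_bot w.ne_bot)]
      refine Finset.sum_congr rfl fun I _ ↦ ?_
      simp only [← dvd_and_dvd_iff_mul_dvd h I, ite_and, mul_ite, mul_one, mul_zero]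
      split_ifs <;> rfl
  have hlin : ∑ I ∈ idealsUpTo K x, (∑ v ∈ B, if v.asIdeal ∣ I then (1 : ℝ) else 0) =
      ∑ v ∈ B, ((idealsUpTo K (x / primeNorm v)).card : ℝ) := by
    rw [Finset.sum_comm]
    exact Finset.sum_congr rfl fun v _ ↦ hcard _ v.ne_bot
  simp_rw [sub_sq]
  rw [Finset.sum_add_distrib, Finset.sum_sub_distrib, hsq, ← Finset.sum_mul, ← Finset.mul_sum,
    hlin, Finset.sum_const, nsmul_eq_mul, turanKubiliusMoment]
  ring

open Classical in
/-- The Turán–Kubilius inequality in dual form: weighting by the number of divisors in `B` is,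
in mean square, close to weighting by the constant `∑_{𝔭 ∈ B} 1 / N(𝔭)`, while a divisor `𝔭`
raises `Ω` by one. -/
theorem abs_sum_sum_sub_le {K : Type*} [Field K] [NumberField K]
    (B : Finset (HeightOneSpectrum (𝓞 K))) (x : ℝ) (g : ℕ → ℝ)
    (hg : ∀ n, |g n| ≤ 1) :
    |(∑ v ∈ B, ∑ J ∈ idealsUpTo K (x / primeNorm v), g (idealOmega J + 1)) -
      invNormSum B * ∑ I ∈ idealsUpTo K x, g (idealOmega I)| ≤
      √((idealsUpTo K x).card * turanKubiliusMoment B x) := by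
  have e : (∑ v ∈ B, ∑ J ∈ idealsUpTo K (x / primeNorm v), g (idealOmega J + 1)) -
      invNormSum B * ∑ I ∈ idealsUpTo K x, g (idealOmega I) =
      ∑ I ∈ idealsUpTo K x, g (idealOmega I) *
        ((∑ v ∈ B, if v.asIdeal ∣ I then (1 : ℝ) else 0) - invNormSum B) := by
    simp_rw [mul_sub, Finset.sum_sub_distrib, ← Finset.sum_mul, Finset.mul_sum]
    rw [Finset.sum_comm (s := idealsUpTo K x)]
    congr 1
    · refine Finset.sum_congr rfl fun v _ ↦ ?_
      simp_rw [mul_ite, mul_one, mul_zero]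
      rw [← Finset.sum_filter, sum_idealsUpTo_filter_dvd v.ne_bot]
      refine Finset.sum_congr rfl fun J hJ ↦ ?_
      rw [idealOmega_mul_prime v (mem_idealsUpTo.1 hJ).1]
    · rw [← Finset.mul_sum, mul_comm]
  rw [e]
  refine Real.abs_le_sqrt ((Finset.sum_mul_sq_le_sq_mul_sq _ _ _).trans ?_)
  rw [sum_sq_count_sub]
  gcongr
  · rw [← sum_sq_count_sub]; exact Finset.sum_nonneg fun _ _ ↦ sq_nonneg _
  · calc _ ≤ ∑ I ∈ idealsUpTo K x, (1 : ℝ) := Finset.sum_le_sum fun I _ ↦ by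
          rw [← sq_abs]; exact pow_le_one₀ (abs_nonneg _) (hg _)
      _ = _ := by simp

open Filter Topology in
theorem tendsto_card_idealsUpTo_div_const {K : Type*} [Field K] [NumberField K] {c : ℝ}
    (hc : Tendsto (fun x : ℝ ↦ ((idealsUpTo K x).card : ℝ) / x) atTop (𝓝 c)) {a : ℝ}
    (ha : 0 < a) :
    Tendsto (fun x : ℝ ↦ ((idealsUpTo K (x / a)).card : ℝ) / x) atTop (𝓝 (c * (1 / a))) := by
  have := (hc.comp (tendsto_id.atTop_div_const ha)).mul_const (1 / a)
  refine this.congr fun x ↦ ?_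
  simp only [Function.comp, id]
  field_simp

open Filter Topology in
/-- Only the diagonal of the second moment survives in the limit, so the mean square deviation is
at most the mean. -/
theorem tendsto_turanKubiliusMoment_div {K : Type*} [Field K] [NumberField K] {c : ℝ}
    (hc : Tendsto (fun x : ℝ ↦ ((idealsUpTo K x).card : ℝ) / x) atTop (𝓝 c))
    (B : Finset (HeightOneSpectrum (𝓞 K))) :
    Tendsto (fun x : ℝ ↦ turanKubiliusMoment B x / x) atTop
      (𝓝 (c * (invNormSum B - ∑ v ∈ B, (1 / primeNorm v) ^ 2))) := by
  classical
  have h1 : Tendsto (fun x : ℝ ↦ ∑ v ∈ B, ∑ w ∈ B,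
      (if v = w then ((idealsUpTo K (x / primeNorm v)).card : ℝ)
        else ((idealsUpTo K (x / (primeNorm v * primeNorm w))).card : ℝ)) / x) atTop
      (𝓝 (∑ v ∈ B, ∑ w ∈ B, if v = w then c * (1 / primeNorm v)
        else c * (1 / (primeNorm v * primeNorm w)))) := by
    refine tendsto_finsetSum _ fun v _ ↦ tendsto_finsetSum _ fun w _ ↦ ?_
    split_ifs
    · exact tendsto_card_idealsUpTo_div_const hc (primeNorm_pos v)
    · exact tendsto_card_idealsUpTo_div_const hc (mul_pos (primeNorm_pos v) (primeNorm_pos w))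
  have h2 : Tendsto (fun x : ℝ ↦ ∑ v ∈ B, ((idealsUpTo K (x / primeNorm v)).card : ℝ) / x) atTop
      (𝓝 (∑ v ∈ B, c * (1 / primeNorm v))) :=
    tendsto_finsetSum _ fun v _ ↦ tendsto_card_idealsUpTo_div_const hc (primeNorm_pos v)
  have h3 := (h1.sub (h2.const_mul (2 * invNormSum B))).add (hc.const_mul (invNormSum B ^ 2))
  have e1 : ∑ v ∈ B, ∑ w ∈ B, (if v = w then c * (1 / primeNorm v)
        else c * (1 / (primeNorm v * primeNorm w))) =
      c * (invNormSum B ^ 2 + invNormSum B - ∑ v ∈ B, (1 / primeNorm v) ^ 2) := by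
    have : ∀ v ∈ B, ∑ w ∈ B, (if v = w then c * (1 / primeNorm v)
        else c * (1 / (primeNorm v * primeNorm w))) =
        c * (1 / primeNorm v * invNormSum B + 1 / primeNorm v - (1 / primeNorm v) ^ 2) := by
      intro v hv
      have h : ∀ w ∈ B, (if v = w then c * (1 / primeNorm v)
          else c * (1 / (primeNorm v * primeNorm w))) =
          c * (1 / primeNorm v) * (1 / primeNorm w) +
            (if v = w then c * (1 / primeNorm v - (1 / primeNorm v) ^ 2) else 0) := by
        intro w _
        split_ifs with h
        · subst h; ring
        · rw [add_zero, mul_assoc, one_div_mul_one_div]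
      rw [Finset.sum_congr rfl h, Finset.sum_add_distrib, ← Finset.mul_sum, Finset.sum_ite_eq,
        if_pos hv, invNormSum]
      ring
    rw [Finset.sum_congr rfl this, ← Finset.mul_sum, Finset.sum_sub_distrib,
      Finset.sum_add_distrib, ← Finset.sum_mul, ← invNormSum]
    ring
  have e2 : ∑ v ∈ B, c * (1 / primeNorm v) = c * invNormSum B := by
    rw [← Finset.mul_sum, invNormSum]
  rw [e1, e2] at h3
  convert h3 using 1
  · ext x
    simp only [turanKubiliusMoment, ← Finset.sum_div]
    ring
  · congr 1; ring

theorem one_le_absNorm {K : Type*} [Field K] [NumberField K] {I : Ideal (𝓞 K)} (hI : I ≠ ⊥) :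
    (1 : ℝ) ≤ Ideal.absNorm I := by
  have : Ideal.absNorm I ≠ 0 := by rwa [Ne, Ideal.absNorm_eq_zero_iff]
  exact_mod_cast Nat.one_le_iff_ne_zero.2 this

open Filter Topology in
theorem exists_card_idealsUpTo_le (K : Type*) [Field K] [NumberField K] :
    ∃ C : ℝ, 0 < C ∧ ∀ x : ℝ, 0 ≤ x → ((idealsUpTo K x).card : ℝ) ≤ C * x := by
  obtain ⟨c, hc0, hc⟩ := exists_tendsto_card_idealsUpTo_div K
  obtain ⟨X, hX⟩ := eventually_atTop.1
    ((hc.eventually_le_const (lt_add_one c)).and (eventually_gt_atTop 0))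
  refine ⟨c + 1 + (idealsUpTo K X).card, by positivity, fun x hx ↦ ?_⟩
  rcases lt_or_ge x 1 with h1 | h1
  · have : idealsUpTo K x = ∅ := by
      refine Finset.eq_empty_of_forall_notMem fun I hI ↦ ?_
      rw [mem_idealsUpTo] at hI
      linarith [one_le_absNorm hI.1, hI.2]
    rw [this]; simp; positivity
  rcases le_total X x with h2 | h2
  · have := (hX x h2).1
    rw [div_le_iff₀ (hX x h2).2] at this
    have h3 : 0 ≤ ((idealsUpTo K X).card : ℝ) * x := by positivity
    linarith
  · have h3 : ((idealsUpTo K x).card : ℝ) ≤ (idealsUpTo K X).card := by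
      exact_mod_cast Finset.card_le_card (idealsUpTo_mono K h2)
    have h4 : ((idealsUpTo K X).card : ℝ) * 1 ≤ ((idealsUpTo K X).card : ℝ) * x := by gcongr
    nlinarith

/-! ### Prime ideals above rational primes -/

theorem exists_prime_mem {K : Type*} [Field K] [NumberField K]
    (v : HeightOneSpectrum (𝓞 K)) : ∃ p : ℕ, p.Prime ∧ (p : 𝓞 K) ∈ v.asIdeal ∧
      ∃ f : ℕ, 0 < f ∧ Ideal.absNorm v.asIdeal = p ^ f := by
  have key : ∀ n : ℕ, n ≠ 0 → (n : 𝓞 K) ∈ v.asIdeal →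
      ∃ p : ℕ, p.Prime ∧ (p : 𝓞 K) ∈ v.asIdeal := by
    intro n
    induction n using Nat.recOnMul with
    | zero => intro h; exact absurd rfl h
    | one =>
      intro _ h
      rw [Nat.cast_one] at h
      exact absurd ((Ideal.eq_top_iff_one _).2 h) v.isPrime.ne_top
    | prime p hp => intro _ h; exact ⟨p, hp, h⟩
    | mul a b iha ihb =>
      intro h0 h
      rw [Nat.cast_mul] at h
      rcases v.isPrime.mem_or_mem h with h | h
      · exact iha (left_ne_zero_of_mul h0) h
      · exact ihb (right_ne_zero_of_mul h0) h
  have h2 := two_le_absNorm v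
  obtain ⟨p, hp, hpv⟩ := key _ (by omega) (Ideal.absNorm_mem v.asIdeal)
  refine ⟨p, hp, hpv, ?_⟩
  have h1 : Ideal.absNorm v.asIdeal ∣ p ^ Module.finrank ℤ (𝓞 K) := by
    rw [← Ideal.absNorm_span_natCast]
    exact Ideal.absNorm_dvd_absNorm_of_le ((Ideal.span_singleton_le_iff_mem _).2 hpv)
  obtain ⟨f, -, hf⟩ := (Nat.dvd_prime_pow hp).1 h1
  refine ⟨f, Nat.pos_of_ne_zero ?_, hf⟩
  rintro rfl
  rw [pow_zero] at hf
  omega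

/-- The rational prime below a prime ideal. -/
noncomputable def residueChar {K : Type*} [Field K] [NumberField K]
    (v : HeightOneSpectrum (𝓞 K)) : ℕ := (exists_prime_mem v).choose

theorem residueChar_prime {K : Type*} [Field K] [NumberField K]
    (v : HeightOneSpectrum (𝓞 K)) : (residueChar v).Prime := (exists_prime_mem v).choose_spec.1

theorem residueChar_mem {K : Type*} [Field K] [NumberField K]
    (v : HeightOneSpectrum (𝓞 K)) : (residueChar v : 𝓞 K) ∈ v.asIdeal :=
  (exists_prime_mem v).choose_spec.2.1

theorem absNorm_eq_residueChar_pow {K : Type*} [Field K] [NumberField K]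
    (v : HeightOneSpectrum (𝓞 K)) :
    ∃ f : ℕ, 0 < f ∧ Ideal.absNorm v.asIdeal = residueChar v ^ f :=
  (exists_prime_mem v).choose_spec.2.2

theorem residueChar_le_primeNorm {K : Type*} [Field K] [NumberField K]
    (v : HeightOneSpectrum (𝓞 K)) : (residueChar v : ℝ) ≤ primeNorm v := by
  obtain ⟨f, hf, h⟩ := absNorm_eq_residueChar_pow v
  rw [primeNorm, h]
  exact_mod_cast Nat.le_self_pow hf.ne' _

/-- The product of the primes above `p` divides `(p)`, which has norm `p ^ [K : ℚ]`. -/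
theorem card_le_finrank_of_residueChar_eq {K : Type*} [Field K] [NumberField K] {p : ℕ}
    (s : Finset (HeightOneSpectrum (𝓞 K))) (hs : ∀ v ∈ s, residueChar v = p) :
    s.card ≤ Module.finrank ℤ (𝓞 K) := by
  rcases s.eq_empty_or_nonempty with rfl | ⟨v₀, hv₀⟩
  · simp
  have hp : p.Prime := hs v₀ hv₀ ▸ residueChar_prime v₀
  have h1 : ∏ v ∈ s, v.asIdeal ∣ Ideal.span {(p : 𝓞 K)} := by
    refine Finset.prod_dvd_of_coprime (fun v _ w _ h ↦ HeightOneSpectrum.isCoprime_of_ne v w h)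
      fun v hv ↦ ?_
    rw [Ideal.dvd_span_singleton, ← hs v hv]
    exact residueChar_mem v
  have h2 : p ^ s.card ∣ p ^ Module.finrank ℤ (𝓞 K) := by
    rw [← Ideal.absNorm_span_natCast]
    refine dvd_trans ?_ (map_dvd Ideal.absNorm h1)
    rw [map_prod, ← Finset.prod_const]
    refine Finset.prod_dvd_prod_of_dvd _ _ fun v hv ↦ ?_
    obtain ⟨f, hf, h⟩ := absNorm_eq_residueChar_pow v
    rw [h, hs v hv]
    exact dvd_pow_self p hf.ne'
  exact (Nat.pow_dvd_pow_iff_le_right hp.one_lt).1 h2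

theorem sum_residueChar_le {K : Type*} [Field K] [NumberField K]
    (s : Finset (HeightOneSpectrum (𝓞 K))) {h : ℕ → ℝ} (hh : ∀ n, 0 ≤ h n) :
    ∑ v ∈ s, h (residueChar v) ≤
      Module.finrank ℤ (𝓞 K) * ∑ p ∈ s.image residueChar, h p := by
  classical
  rw [Finset.sum_comp, Finset.mul_sum]
  refine Finset.sum_le_sum fun p _ ↦ ?_
  rw [nsmul_eq_mul]
  refine mul_le_mul_of_nonneg_right ?_ (hh p)
  exact_mod_cast card_le_finrank_of_residueChar_eq _ fun v hv ↦ (Finset.mem_filter.1 hv).2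

/-! ### Thin sets of prime ideals -/

/-- A set of primes is thin if the sum of `1 / N(𝔭)` over it converges, expressed as boundedness
of the sums over finite subsets. -/
def IsThin {K : Type*} [Field K] [NumberField K] (E : Set (HeightOneSpectrum (𝓞 K))) : Prop :=
  ∃ C : ℝ, ∀ s : Finset (HeightOneSpectrum (𝓞 K)), (∀ v ∈ s, v ∈ E) → invNormSum s ≤ C

theorem IsThin.union {K : Type*} [Field K] [NumberField K]
    {E F : Set (HeightOneSpectrum (𝓞 K))} (hE : IsThin E) (hF : IsThin F) : IsThin (E ∪ F) := by
  classical
  obtain ⟨C, hC⟩ := hE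
  obtain ⟨D, hD⟩ := hF
  refine ⟨C + D, fun s hs ↦ ?_⟩
  rw [invNormSum, ← Finset.sum_filter_add_sum_filter_not s (· ∈ E)]
  refine add_le_add (hC _ fun v hv ↦ (Finset.mem_filter.1 hv).2) (hD _ fun v hv ↦ ?_)
  rw [Finset.mem_filter] at hv
  exact (hs v hv.1).resolve_left hv.2

theorem IsThin.mono {K : Type*} [Field K] [NumberField K]
    {E F : Set (HeightOneSpectrum (𝓞 K))} (hF : IsThin F) (h : E ⊆ F) : IsThin E := by
  obtain ⟨D, hD⟩ := hF
  exact ⟨D, fun s hs ↦ hD s fun v hv ↦ h (hs v hv)⟩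

theorem isThin_biUnion {K : Type*} [Field K] [NumberField K] {ι : Type*} (t : Finset ι)
    {E : ι → Set (HeightOneSpectrum (𝓞 K))} (h : ∀ i ∈ t, IsThin (E i)) :
    IsThin (⋃ i ∈ t, E i) := by
  classical
  induction t using Finset.induction_on with
  | empty => exact ⟨0, fun s hs ↦ by
      have : s = ∅ := Finset.eq_empty_of_forall_notMem fun v hv ↦ by simpa using hs v hv
      simp [this, invNormSum]⟩
  | insert i t hi ih =>
    rw [Finset.set_biUnion_insert]
    exact (h i (Finset.mem_insert_self i t)).union
      (ih fun j hj ↦ h j (Finset.mem_insert_of_mem hj))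

theorem isThin_norm_not_prime (K : Type*) [Field K] [NumberField K] :
    IsThin {v : HeightOneSpectrum (𝓞 K) | ¬ (Ideal.absNorm v.asIdeal).Prime} := by
  have hsum : Summable (fun n : ℕ ↦ 1 / (n : ℝ) ^ 2) := Real.summable_one_div_nat_pow.2 one_lt_two
  refine ⟨Module.finrank ℤ (𝓞 K) * ∑' n : ℕ, 1 / (n : ℝ) ^ 2, fun s hs ↦ ?_⟩
  calc invNormSum s ≤ ∑ v ∈ s, 1 / (residueChar v : ℝ) ^ 2 := by
        refine Finset.sum_le_sum fun v hv ↦ ?_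
        have hp := residueChar_prime v
        have hp0 : (0 : ℝ) < residueChar v := by exact_mod_cast hp.pos
        obtain ⟨f, hf, h⟩ := absNorm_eq_residueChar_pow v
        have hf2 : 2 ≤ f := by
          by_contra hlt
          have : f = 1 := by omega
          rw [this, pow_one] at h
          exact hs v hv (h ▸ hp)
        rw [primeNorm, h, Nat.cast_pow]
        have : (1 : ℝ) ≤ residueChar v := by exact_mod_cast hp.one_lt.le
        gcongr
    _ ≤ _ := sum_residueChar_le s (h := fun n ↦ 1 / (n : ℝ) ^ 2) fun n ↦ by positivity
    _ ≤ _ := by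
        gcongr
        exact hsum.sum_le_tsum _ fun n _ ↦ by positivity

theorem exists_sum_log_div_sq_le (K : Type*) [Field K] [NumberField K] :
    ∃ C : ℝ, 0 ≤ C ∧ ∀ s : Finset (HeightOneSpectrum (𝓞 K)),
      ∑ v ∈ s, Real.log (primeNorm v) / primeNorm v ^ 2 ≤ C := by
  have hsum : Summable (fun n : ℕ ↦ 2 * (1 / (n : ℝ) ^ (3 / 2 : ℝ))) :=
    (Real.summable_one_div_nat_rpow.2 (by norm_num)).mul_left 2
  refine ⟨Module.finrank ℤ (𝓞 K) * ∑' n : ℕ, 2 * (1 / (n : ℝ) ^ (3 / 2 : ℝ)), ?_, fun s ↦ ?_⟩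
  · exact mul_nonneg (by positivity) (tsum_nonneg fun n ↦ by positivity)
  calc _ ≤ ∑ v ∈ s, 2 * (1 / (residueChar v : ℝ) ^ (3 / 2 : ℝ)) := by
        refine Finset.sum_le_sum fun v hv ↦ ?_
        have hp0 : (0 : ℝ) < residueChar v := by exact_mod_cast (residueChar_prime v).pos
        have hN := primeNorm_pos v
        have h1 : Real.log (primeNorm v) ≤ primeNorm v ^ (1 / 2 : ℝ) / (1 / 2) :=
          Real.log_le_rpow_div hN.le (by norm_num)
        calc Real.log (primeNorm v) / primeNorm v ^ 2
            ≤ (primeNorm v ^ (1 / 2 : ℝ) / (1 / 2)) / primeNorm v ^ 2 := by gcongr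
          _ = 2 * (1 / primeNorm v ^ (3 / 2 : ℝ)) := by
              rw [show primeNorm v ^ 2 = primeNorm v ^ (1 / 2 : ℝ) * primeNorm v ^ (3 / 2 : ℝ) by
                rw [← Real.rpow_add hN, ← Real.rpow_natCast]; norm_num]
              have : 0 < primeNorm v ^ (1 / 2 : ℝ) := by positivity
              field_simp
          _ ≤ _ := by
              gcongr
              exact residueChar_le_primeNorm v
    _ ≤ _ := sum_residueChar_le s (h := fun n ↦ 2 * (1 / (n : ℝ) ^ (3 / 2 : ℝ)))
        fun n ↦ by positivity
    _ ≤ _ := by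
        gcongr
        exact hsum.sum_le_tsum _ fun n _ ↦ by positivity

/-! ### Chebyshev's lower bound for prime ideals -/

theorem finite_primesUpTo (K : Type*) [Field K] [NumberField K] (x : ℝ) :
    {v : HeightOneSpectrum (𝓞 K) | primeNorm v ≤ x}.Finite := by
  refine Set.Finite.of_finite_image ((finite_idealsUpTo K x).subset ?_)
    (HeightOneSpectrum.asIdeal_injective.injOn)
  rintro _ ⟨v, hv, rfl⟩
  exact ⟨v.ne_bot, hv⟩

/-- The nonzero prime ideals of norm at most `x`. -/
noncomputable def primesUpTo (K : Type*) [Field K] [NumberField K] (x : ℝ) :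
    Finset (HeightOneSpectrum (𝓞 K)) := (finite_primesUpTo K x).toFinset

theorem mem_primesUpTo {K : Type*} [Field K] [NumberField K] {x : ℝ}
    {v : HeightOneSpectrum (𝓞 K)} : v ∈ primesUpTo K x ↔ primeNorm v ≤ x := by
  simp [primesUpTo]

theorem log_primeNorm_pos {K : Type*} [Field K] [NumberField K]
    (v : HeightOneSpectrum (𝓞 K)) : 0 < Real.log (primeNorm v) :=
  Real.log_pos (by linarith [two_le_primeNorm v])

open Classical in
/-- `log N(I)` is at most the sum of `log N(𝔭)` over the prime powers `𝔭 ^ (k + 1)` dividing `I`.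
The bound `x < 2 ^ M` makes the range `k < M` contain every exponent that occurs. -/
theorem log_absNorm_le {K : Type*} [Field K] [NumberField K] {x : ℝ} {M : ℕ}
    (hM : x < 2 ^ M) {I : Ideal (𝓞 K)} (hI : I ∈ idealsUpTo K x) :
    Real.log (Ideal.absNorm I) ≤ ∑ v ∈ primesUpTo K x, ∑ k ∈ Finset.range M,
      if v.asIdeal ^ (k + 1) ∣ I then Real.log (primeNorm v) else 0 := by
  rw [mem_idealsUpTo] at hI
  set nf := UniqueFactorizationMonoid.normalizedFactors I with hnf
  have hlog : ∀ m : Multiset (Ideal (𝓞 K)), (∀ P ∈ m, P ≠ ⊥) →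
      Real.log (Ideal.absNorm m.prod) =
      (m.map fun P ↦ Real.log (Ideal.absNorm P)).sum := by
    intro m
    induction m using Multiset.induction_on with
    | empty => simp
    | cons P m ih =>
      intro h
      have h1 := one_le_absNorm (h P (Multiset.mem_cons_self P m))
      have hm : m.prod ≠ ⊥ := by
        intro h0
        have : (0 : Ideal (𝓞 K)) ∈ m := Multiset.prod_eq_zero_iff.1 h0
        exact h _ (Multiset.mem_cons_of_mem this) rfl
      have h2 := one_le_absNorm hm
      rw [Multiset.prod_cons, map_mul, Nat.cast_mul, Real.log_mul (by positivity) (by positivity),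
        Multiset.map_cons, Multiset.sum_cons, ih fun Q hQ ↦ h Q (Multiset.mem_cons_of_mem hQ)]
  have hprime : ∀ P ∈ nf, Prime P := fun P hP ↦
    UniqueFactorizationMonoid.prime_of_normalized_factor P hP
  have hprod : nf.prod = I := associated_iff_eq.1
    (UniqueFactorizationMonoid.prod_normalizedFactors hI.1)
  have hpow : ∀ k, ∀ P ∈ nf, k ≤ nf.count P → P ^ k ∣ I := by
    intro k P hP hk
    rw [← hprod]
    have : Multiset.replicate k P ≤ nf := Multiset.le_count_iff_replicate_le.1 hk
    simpa using Multiset.prod_dvd_prod_of_le this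
  calc Real.log (Ideal.absNorm I) = (nf.map fun P ↦ Real.log (Ideal.absNorm P)).sum := by
        rw [← hlog nf fun P hP ↦ (hprime P hP).ne_zero, hprod]
    _ = ∑ P ∈ nf.toFinset, nf.count P • Real.log (Ideal.absNorm P) :=
        Finset.sum_multiset_map_count _ _
    _ ≤ ∑ P ∈ (primesUpTo K x).image HeightOneSpectrum.asIdeal,
          nf.count P • Real.log (Ideal.absNorm P) := by
        refine Finset.sum_le_sum_of_subset_of_nonneg ?_ fun P _ _ ↦ ?_
        · intro P hP
          rw [Multiset.mem_toFinset] at hP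
          refine Finset.mem_image.2 ⟨HeightOneSpectrum.ofPrime (hprime P hP), ?_, rfl⟩
          rw [mem_primesUpTo]
          refine le_trans ?_ hI.2
          have hd : Ideal.absNorm P ∣ Ideal.absNorm I :=
            map_dvd _ (UniqueFactorizationMonoid.dvd_of_mem_normalizedFactors hP)
          have : Ideal.absNorm I ≠ 0 := by rw [Ne, Ideal.absNorm_eq_zero_iff]; exact hI.1
          unfold primeNorm
          exact_mod_cast Nat.le_of_dvd (by omega) hd
        · exact nsmul_nonneg (Real.log_natCast_nonneg _) _
    _ = ∑ v ∈ primesUpTo K x, nf.count v.asIdeal • Real.log (primeNorm v) := by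
        rw [Finset.sum_image HeightOneSpectrum.asIdeal_injective.injOn]
        rfl
    _ ≤ _ := by
        refine Finset.sum_le_sum fun v _ ↦ ?_
        rw [← Finset.sum_filter, Finset.sum_const]
        refine nsmul_le_nsmul_left (log_primeNorm_pos v).le ?_
        by_cases hv : v.asIdeal ∈ nf
        · have hcount : nf.count v.asIdeal ≤ M := by
            by_contra hlt
            have hd := map_dvd Ideal.absNorm (hpow M v.asIdeal hv (by omega))
            have h0 : Ideal.absNorm I ≠ 0 := by rw [Ne, Ideal.absNorm_eq_zero_iff]; exact hI.1
            have h1 := Nat.le_of_dvd (by omega) hd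
            rw [map_pow] at h1
            have h2 : 2 ^ M ≤ Ideal.absNorm v.asIdeal ^ M :=
              Nat.pow_le_pow_left (two_le_absNorm v) M
            have h3 : ((2 : ℝ) ^ M) ≤ Ideal.absNorm I := by exact_mod_cast h2.trans h1
            linarith [hI.2]
          calc nf.count v.asIdeal = (Finset.range (nf.count v.asIdeal)).card := by simp
            _ ≤ _ := by
              refine Finset.card_le_card fun k hk ↦ ?_
              rw [Finset.mem_range] at hk
              rw [Finset.mem_filter, Finset.mem_range]
              exact ⟨by omega, hpow _ _ hv hk⟩
        · rw [Multiset.count_eq_zero_of_notMem hv]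
          exact Nat.zero_le _

theorem sum_one_div_pow_le {q : ℝ} (hq : 2 ≤ q) (M : ℕ) :
    ∑ k ∈ Finset.range M, 1 / q ^ (k + 1) ≤ 1 / q + 2 / q ^ 2 := by
  have h : ∀ M : ℕ, ∑ k ∈ Finset.range M, 1 / q ^ (k + 1) ≤ (1 - 1 / q ^ M) / (q - 1) := by
    intro M
    have hq1 : 0 < q - 1 := by linarith
    have hq0 : 0 < q := by linarith
    induction M with
    | zero => simp
    | succ M ih =>
      rw [Finset.sum_range_succ]
      have : (1 - 1 / q ^ M) / (q - 1) + 1 / q ^ (M + 1) = (1 - 1 / q ^ (M + 1)) / (q - 1) := by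
        field_simp; ring
      linarith
  have hq1 : 0 < q - 1 := by linarith
  have hq0 : 0 < q := by linarith
  calc _ ≤ (1 - 1 / q ^ M) / (q - 1) := h M
    _ ≤ 1 / (q - 1) := by gcongr; linarith [show 0 ≤ 1 / q ^ M by positivity]
    _ ≤ _ := by
      rw [div_add_div _ _ (by positivity) (by positivity), div_le_div_iff₀ hq1 (by positivity)]
      nlinarith [sq_nonneg q, mul_nonneg hq0.le (by linarith : 0 ≤ q - 2)]

open Classical in
theorem sum_log_absNorm_le {K : Type*} [Field K] [NumberField K] {C : ℝ}
    (hC : ∀ x : ℝ, 0 ≤ x → ((idealsUpTo K x).card : ℝ) ≤ C * x) {x : ℝ} (hx : 0 ≤ x) :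
    ∑ I ∈ idealsUpTo K x, Real.log (Ideal.absNorm I) ≤
      C * x * ∑ v ∈ primesUpTo K x,
        Real.log (primeNorm v) * (1 / primeNorm v + 2 / primeNorm v ^ 2) := by
  obtain ⟨M, hM⟩ := pow_unbounded_of_one_lt x (one_lt_two : (1 : ℝ) < 2)
  have hCx : 0 ≤ C * x := le_trans (Nat.cast_nonneg _) (hC x hx)
  calc _ ≤ ∑ I ∈ idealsUpTo K x, ∑ v ∈ primesUpTo K x, ∑ k ∈ Finset.range M,
        (if v.asIdeal ^ (k + 1) ∣ I then Real.log (primeNorm v) else 0) :=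
        Finset.sum_le_sum fun I hI ↦ log_absNorm_le hM hI
    _ = ∑ v ∈ primesUpTo K x, ∑ k ∈ Finset.range M, Real.log (primeNorm v) *
          ((idealsUpTo K (x / primeNorm v ^ (k + 1))).card : ℝ) := by
        rw [Finset.sum_comm]
        refine Finset.sum_congr rfl fun v _ ↦ ?_
        rw [Finset.sum_comm]
        refine Finset.sum_congr rfl fun k _ ↦ ?_
        rw [← Finset.sum_filter, sum_idealsUpTo_filter_dvd (pow_ne_zero _ v.ne_bot), map_pow,
          Nat.cast_pow, ← primeNorm, Finset.sum_const, nsmul_eq_mul, mul_comm]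
    _ ≤ ∑ v ∈ primesUpTo K x, ∑ k ∈ Finset.range M, Real.log (primeNorm v) *
          (C * x * (1 / primeNorm v ^ (k + 1))) := by
        refine Finset.sum_le_sum fun v _ ↦ Finset.sum_le_sum fun k _ ↦ ?_
        have := primeNorm_pos v
        refine mul_le_mul_of_nonneg_left ?_ (log_primeNorm_pos v).le
        rw [mul_assoc, mul_one_div]
        exact hC _ (by positivity)
    _ ≤ _ := by
        rw [Finset.mul_sum]
        refine Finset.sum_le_sum fun v _ ↦ ?_
        rw [← Finset.mul_sum, ← Finset.mul_sum, mul_left_comm]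
        gcongr
        · exact (log_primeNorm_pos v).le
        · exact sum_one_div_pow_le (two_le_primeNorm v) M

open Filter Topology in
/-- A positive proportion of the ideals of norm at most `x` have norm above `√x`. -/
theorem exists_le_sum_log_absNorm (K : Type*) [Field K] [NumberField K] :
    ∃ a : ℝ, 0 < a ∧ ∀ᶠ x : ℝ in atTop,
      a * x * Real.log x ≤ ∑ I ∈ idealsUpTo K x, Real.log (Ideal.absNorm I) := by
  obtain ⟨c, hc0, hc⟩ := exists_tendsto_card_idealsUpTo_div K
  have h2 : Tendsto (fun x : ℝ ↦ ((idealsUpTo K √x).card : ℝ) / x) atTop (𝓝 (c * 0)) := by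
    have := (hc.comp Real.tendsto_sqrt_atTop).mul
      (tendsto_inv_atTop_zero.comp Real.tendsto_sqrt_atTop)
    refine this.congr' ?_
    filter_upwards [eventually_gt_atTop 0] with x hx
    simp only [Function.comp]
    rw [div_mul_eq_mul_div, ← div_eq_mul_inv, div_div, Real.mul_self_sqrt hx.le]
  have h3 := hc.sub h2
  rw [mul_zero, sub_zero] at h3
  refine ⟨c / 4, by positivity, ?_⟩
  filter_upwards [h3.eventually_const_le (half_lt_self hc0), eventually_gt_atTop 1] with x hx hx1
  rw [← sub_div, le_div_iff₀ (by linarith)] at hx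
  have hsub : idealsUpTo K √x ⊆ idealsUpTo K x :=
    idealsUpTo_mono K (Real.sqrt_le_iff.2 ⟨by linarith, by nlinarith⟩)
  classical
  calc c / 4 * x * Real.log x = (c / 2 * x) * (Real.log x / 2) := by ring
    _ ≤ (((idealsUpTo K x).card : ℝ) - (idealsUpTo K √x).card) * (Real.log x / 2) := by
        have := Real.log_nonneg hx1.le
        gcongr
    _ = ∑ I ∈ idealsUpTo K x \ idealsUpTo K √x, Real.log x / 2 := by
        rw [Finset.sum_const, nsmul_eq_mul, Finset.cast_card_sdiff hsub]
    _ ≤ ∑ I ∈ idealsUpTo K x \ idealsUpTo K √x, Real.log (Ideal.absNorm I) := by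
        refine Finset.sum_le_sum fun I hI ↦ ?_
        rw [Finset.mem_sdiff, mem_idealsUpTo, mem_idealsUpTo] at hI
        rw [← Real.log_sqrt (by linarith)]
        refine Real.log_le_log (Real.sqrt_pos.2 (by linarith)) ?_
        by_contra hlt
        exact hI.2 ⟨hI.1.1, (not_le.1 hlt).le⟩
    _ ≤ _ := Finset.sum_le_sum_of_subset_of_nonneg Finset.sdiff_subset
        fun I _ _ ↦ Real.log_natCast_nonneg _

open Filter Topology in
/-- A Chebyshev type lower bound for the prime ideals, from two evaluations of
`∑_{N(𝔪) ≤ x} log N(𝔪)`. -/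
theorem exists_le_sum_log_primeNorm_div (K : Type*) [Field K] [NumberField K] :
    ∃ κ : ℝ, 0 < κ ∧ ∀ᶠ x : ℝ in atTop,
      κ * Real.log x ≤ ∑ v ∈ primesUpTo K x, Real.log (primeNorm v) / primeNorm v := by
  obtain ⟨C, hC0, hC⟩ := exists_card_idealsUpTo_le K
  obtain ⟨a, ha0, ha⟩ := exists_le_sum_log_absNorm K
  obtain ⟨C₁, hC₁0, hC₁⟩ := exists_sum_log_div_sq_le K
  refine ⟨a / (2 * C), by positivity, ?_⟩
  filter_upwards [ha, eventually_gt_atTop 1,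
    Real.tendsto_log_atTop.eventually_ge_atTop (2 * C₁ / (a / (2 * C)))] with x hx hx1 hxl
  have h1 := hx.trans (sum_log_absNorm_le hC (by linarith))
  have h2 : ∑ v ∈ primesUpTo K x, Real.log (primeNorm v) *
      (1 / primeNorm v + 2 / primeNorm v ^ 2) =
      ∑ v ∈ primesUpTo K x, Real.log (primeNorm v) / primeNorm v +
        2 * ∑ v ∈ primesUpTo K x, Real.log (primeNorm v) / primeNorm v ^ 2 := by
    rw [Finset.mul_sum, ← Finset.sum_add_distrib]
    exact Finset.sum_congr rfl fun v _ ↦ by ring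
  rw [h2] at h1
  have h3 := hC₁ (primesUpTo K x)
  have h4 : a / C * Real.log x ≤ ∑ v ∈ primesUpTo K x, Real.log (primeNorm v) / primeNorm v +
        2 * ∑ v ∈ primesUpTo K x, Real.log (primeNorm v) / primeNorm v ^ 2 := by
    refine le_of_mul_le_mul_left ?_ (by positivity : 0 < C * x)
    refine le_trans (le_of_eq ?_) h1
    field_simp
  rw [div_le_iff₀ (by positivity)] at hxl
  have h5 : a / C = 2 * (a / (2 * C)) := by field_simp
  rw [h5] at h4
  linarith

open Filter Topology in
/-- Thin sets are negligible for the logarithmic weight: split off a finite part carrying almost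
all of the sum of `1 / N(𝔭)`, and bound `log N(𝔭)` by `log x` on the rest. -/
theorem IsThin.eventually_sum_log_le {K : Type*} [Field K] [NumberField K]
    {E : Set (HeightOneSpectrum (𝓞 K))} (hE : IsThin E) {κ : ℝ} (hκ : 0 < κ) :
    ∀ᶠ x : ℝ in atTop, ∀ s : Finset (HeightOneSpectrum (𝓞 K)),
      (∀ v ∈ s, v ∈ E ∧ primeNorm v ≤ x) →
      ∑ v ∈ s, Real.log (primeNorm v) / primeNorm v ≤ κ * Real.log x := by
  classical
  obtain ⟨C, hC⟩ := hE
  set S : Set ℝ := {r | ∃ s : Finset (HeightOneSpectrum (𝓞 K)), (∀ v ∈ s, v ∈ E) ∧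
    invNormSum s = r}
  have hS : BddAbove S := ⟨C, by rintro _ ⟨s, hs, rfl⟩; exact hC s hs⟩
  have hS' : S.Nonempty := ⟨_, ∅, by simp, rfl⟩
  obtain ⟨_, ⟨t, ht, rfl⟩, htS⟩ := exists_lt_of_lt_csSup hS' (sub_lt_self (sSup S) (half_pos hκ))
  filter_upwards [eventually_gt_atTop 1, Real.tendsto_log_atTop.eventually_ge_atTop
    ((∑ v ∈ t, Real.log (primeNorm v) / primeNorm v) / (κ / 2))] with x hx hxl s hs
  rw [div_le_iff₀ (by positivity)] at hxl
  rw [← Finset.sum_filter_add_sum_filter_not s (· ∈ t)]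
  have h1 : ∑ v ∈ s with v ∈ t, Real.log (primeNorm v) / primeNorm v ≤
      ∑ v ∈ t, Real.log (primeNorm v) / primeNorm v := by
    refine Finset.sum_le_sum_of_subset_of_nonneg (fun v hv ↦ (Finset.mem_filter.1 hv).2)
      fun v _ _ ↦ div_nonneg (log_primeNorm_pos v).le (primeNorm_pos v).le
  have h2 : ∑ v ∈ s with v ∉ t, Real.log (primeNorm v) / primeNorm v ≤
      Real.log x * invNormSum (s.filter (· ∉ t)) := by
    rw [invNormSum, Finset.mul_sum]
    refine Finset.sum_le_sum fun v hv ↦ ?_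
    rw [mul_one_div]
    have := primeNorm_pos v
    gcongr
    exact (hs v (Finset.mem_filter.1 hv).1).2
  have h3 : invNormSum (t ∪ s.filter (· ∉ t)) ≤ sSup S := by
    refine le_csSup hS ⟨_, fun v hv ↦ ?_, rfl⟩
    rcases Finset.mem_union.1 hv with h | h
    · exact ht v h
    · exact (hs v (Finset.mem_filter.1 h).1).1
  have hdisj : Disjoint t (s.filter (· ∉ t)) :=
    Finset.disjoint_left.2 fun v hv hv' ↦ (Finset.mem_filter.1 hv').2 hv
  rw [invNormSum, Finset.sum_union hdisj, ← invNormSum, ← invNormSum] at h3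
  have h4 : Real.log x * invNormSum (s.filter (· ∉ t)) ≤ Real.log x * (κ / 2) := by
    have := Real.log_nonneg hx.le
    gcongr
    linarith
  linarith

/-! ### Pairs of primes at a small logarithmic distance -/

/-- Primes of prime norm do not concentrate, as at most `[K : ℚ]` of them lie above each rational
prime. -/
theorem exists_sum_log_primeNorm_div_le (K : Type*) [Field K] [NumberField K] {δ : ℝ}
    (hδ : 0 < δ) (hδ1 : δ ≤ 1 / 2) :
    ∃ V₀ : ℝ, ∀ V ≥ V₀, ∀ s : Finset (HeightOneSpectrum (𝓞 K)),
      (∀ v ∈ s, (Ideal.absNorm v.asIdeal).Prime) →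
      (∀ v ∈ s, V ≤ Real.log (primeNorm v) ∧ Real.log (primeNorm v) ≤ V + δ) →
      ∑ v ∈ s, Real.log (primeNorm v) / primeNorm v ≤
        Module.finrank ℤ (𝓞 K) * (5 * δ) := by
  classical
  obtain ⟨V₀, hV₀⟩ := exists_sum_log_div_le hδ hδ1
  refine ⟨V₀, fun V hV s hs hsV ↦ ?_⟩
  have hN : ∀ v ∈ s, primeNorm v = residueChar v := by
    intro v hv
    obtain ⟨f, hf, h⟩ := absNorm_eq_residueChar_pow v
    have hp := hs v hv
    rw [h] at hp
    rw [primeNorm, h, hp.eq_one_of_pow, pow_one]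
  calc _ = ∑ v ∈ s, Real.log (residueChar v : ℝ) / (residueChar v : ℝ) :=
        Finset.sum_congr rfl fun v hv ↦ by rw [hN v hv]
    _ ≤ _ := sum_residueChar_le s (h := fun n ↦ Real.log n / n)
        fun n ↦ div_nonneg (Real.log_natCast_nonneg n) (Nat.cast_nonneg n)
    _ ≤ _ := by
        refine mul_le_mul_of_nonneg_left ?_ (Nat.cast_nonneg _)
        refine hV₀ V hV _ ?_ ?_
        · intro p hp
          obtain ⟨v, -, rfl⟩ := Finset.mem_image.1 hp
          exact residueChar_prime v
        · intro p hp
          obtain ⟨v, hv, rfl⟩ := Finset.mem_image.1 hp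
          rw [← hN v hv]
          exact hsV v hv

open Filter Topology in
/-- Outside a thin set one finds two primes the logarithms of whose norms differ by a small amount
which is bounded below independently of the thin set. Otherwise the primes outside the thin set
occupy, in each window of logarithmic length `η`, only a part of length `δ`, and their total weight
is too small for Chebyshev's lower bound. -/
theorem exists_primes_log_sub_mem_Icc (K : Type*) [Field K] [NumberField K] {η : ℝ}
    (hη : 0 < η) :
    ∃ δ : ℝ, 0 < δ ∧ ∀ E : Set (HeightOneSpectrum (𝓞 K)), IsThin E →
      ∃ v w : HeightOneSpectrum (𝓞 K), v ∉ E ∧ w ∉ E ∧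
        Real.log (primeNorm w) - Real.log (primeNorm v) ∈ Set.Icc δ η := by
  classical
  obtain ⟨κ, hκ0, hκ⟩ := exists_le_sum_log_primeNorm_div K
  set D : ℝ := Module.finrank ℤ (𝓞 K) + 1 with hD
  have hD0 : 0 < D := by positivity
  -- With this `δ`, windows of weight `5 * D * δ` add up to at most `(κ / 4) * log x`.
  set δ : ℝ := min (1 / 2) (κ * η / (20 * D)) with hδ
  have hδ0 : 0 < δ := lt_min (by norm_num) (by positivity)
  have hδη : 5 * D * δ / η ≤ κ / 4 := by
    have : δ ≤ κ * η / (20 * D) := min_le_right _ _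
    rw [le_div_iff₀ (by positivity)] at this
    rw [div_le_iff₀ hη]
    linarith
  refine ⟨δ, hδ0, fun E₁ hE₁ ↦ ?_⟩
  set E := E₁ ∪ {v : HeightOneSpectrum (𝓞 K) | ¬ (Ideal.absNorm v.asIdeal).Prime} with hE
  have hEthin : IsThin E := hE₁.union (isThin_norm_not_prime K)
  by_contra! hcon
  have hcon' : ∀ v w : HeightOneSpectrum (𝓞 K), v ∉ E → w ∉ E →
      Real.log (primeNorm w) - Real.log (primeNorm v) ≤ η →
      Real.log (primeNorm w) ≤ Real.log (primeNorm v) + δ := by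
    intro v w hv hw h
    by_contra! hlt
    exact hcon v w (fun h ↦ hv (Or.inl h)) (fun h ↦ hw (Or.inl h)) ⟨by linarith, h⟩
  obtain ⟨V₀, hV₀⟩ := exists_sum_log_primeNorm_div_le K hδ0 (min_le_left _ _)
  set C₂ := ∑ v ∈ primesUpTo K (Real.exp V₀), Real.log (primeNorm v) / primeNorm v
  have hnn : ∀ v : HeightOneSpectrum (𝓞 K), 0 ≤ Real.log (primeNorm v) / primeNorm v :=
    fun v ↦ div_nonneg (log_primeNorm_pos v).le (primeNorm_pos v).le
  obtain ⟨x, hx, hxE, hx1, hxl⟩ := (hκ.and ((hEthin.eventually_sum_log_le (half_pos hκ0)).and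
    ((eventually_gt_atTop 1).and (Real.tendsto_log_atTop.eventually_gt_atTop
    ((C₂ + 5 * D * δ) / (κ / 4)))))).exists
  rw [div_lt_iff₀ (by positivity)] at hxl
  have hlx : 0 < Real.log x := Real.log_pos hx1
  set T := primesUpTo K x
  have h1 := hxE (T.filter (· ∈ E)) fun v hv ↦
    ⟨(Finset.mem_filter.1 hv).2, mem_primesUpTo.1 (Finset.mem_filter.1 hv).1⟩
  rw [← Finset.sum_filter_add_sum_filter_not T (· ∈ E)] at hx
  set G := T.filter (· ∉ E)
  have hG : ∀ v ∈ G, v ∉ E ∧ Real.log (primeNorm v) ≤ Real.log x := by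
    intro v hv
    rw [Finset.mem_filter, mem_primesUpTo] at hv
    exact ⟨hv.2, Real.log_le_log (primeNorm_pos v) hv.1⟩
  have h2 : ∑ v ∈ G, Real.log (primeNorm v) / primeNorm v ≤
      C₂ + (Real.log x / η + 1) * (D * (5 * δ)) := by
    rw [← Finset.sum_filter_not_add_sum_filter G (fun v ↦ V₀ ≤ Real.log (primeNorm v))]
    refine add_le_add ?_ ?_
    · refine Finset.sum_le_sum_of_subset_of_nonneg (fun v hv ↦ ?_) fun v _ _ ↦ hnn v
      rw [mem_primesUpTo, ← Real.log_le_iff_le_exp (primeNorm_pos v)]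
      exact (not_le.1 (Finset.mem_filter.1 hv).2).le
    · set G' := G.filter (fun v ↦ V₀ ≤ Real.log (primeNorm v))
      set J := ⌊Real.log x / η⌋₊
      have hmaps : ∀ v ∈ G', ⌊Real.log (primeNorm v) / η⌋₊ ∈ Finset.range (J + 1) := by
        intro v hv
        rw [Finset.mem_range, Nat.lt_succ_iff]
        exact Nat.floor_le_floor
          (div_le_div_of_nonneg_right (hG v (Finset.mem_filter.1 hv).1).2 hη.le)
      rw [← Finset.sum_fiberwise_of_maps_to hmaps]
      calc _ ≤ ∑ j ∈ Finset.range (J + 1), D * (5 * δ) := by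
            refine Finset.sum_le_sum fun j _ ↦ ?_
            set W := G'.filter fun v ↦ ⌊Real.log (primeNorm v) / η⌋₊ = j with hW
            rcases W.eq_empty_or_nonempty with h | h
            · rw [h, Finset.sum_empty]; positivity
            obtain ⟨v, hv, hmin⟩ := W.exists_min_image (fun v ↦ Real.log (primeNorm v)) h
            have hWm : ∀ w ∈ W, w ∉ E ∧ V₀ ≤ Real.log (primeNorm w) ∧
                ⌊Real.log (primeNorm w) / η⌋₊ = j := by
              intro w hw
              rw [hW, Finset.mem_filter, Finset.mem_filter] at hw
              exact ⟨(hG w hw.1.1).1, hw.1.2, hw.2⟩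
            have := hV₀ (Real.log (primeNorm v)) (hWm v hv).2.1 W
              (fun w hw ↦ by
                by_contra hnp
                exact (hWm w hw).1 (Or.inr hnp))
              (fun w hw ↦ by
                refine ⟨hmin w hw, hcon' v w (hWm v hv).1 (hWm w hw).1 ?_⟩
                have h3 := Nat.lt_floor_add_one (Real.log (primeNorm w) / η)
                have h4 := Nat.floor_le (div_nonneg (log_primeNorm_pos v).le hη.le)
                rw [(hWm w hw).2.2, div_lt_iff₀ hη] at h3
                rw [(hWm v hv).2.2, le_div_iff₀ hη] at h4
                linarith)
            refine this.trans ?_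
            gcongr
            rw [hD]; linarith
        _ = ((J : ℝ) + 1) * (D * (5 * δ)) := by
            rw [Finset.sum_const, Finset.card_range, nsmul_eq_mul]; push_cast; ring
        _ ≤ _ := by
            gcongr
            exact Nat.floor_le (by positivity)
  have h3 : Real.log x / η * (D * (5 * δ)) ≤ κ / 4 * Real.log x := by
    calc _ = (5 * D * δ / η) * Real.log x := by ring
      _ ≤ _ := by gcongr
  linarith

/-! ### Approximately harmonic functions -/

/-- A function that is approximately harmonic along most primes has arbitrarily small approximate
periods. If `𝔭` and `𝔮` avoid the exceptional sets and `d = log N(𝔮) - log N(𝔭)`, then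
`F k u` and `F k (u + d)` are both close to `F (k + 1) (u - log N(𝔭))`. -/
theorem exists_abs_translate_sub_le (K : Type*) [Field K] [NumberField K] {F : ℕ → ℝ → ℝ}
    {A : ℝ} (hA : 0 ≤ A) (hLip : ∀ k u w, |F k u - F k w| ≤ A * |u - w|)
    (hthin : ∀ k u ε, 0 < ε → IsThin {v : HeightOneSpectrum (𝓞 K) |
      ε ≤ |F (k + 1) (u - Real.log (primeNorm v)) - F k u|})
    {η : ℝ} (hη : 0 < η) :
    ∃ δ : ℝ, 0 < δ ∧ ∀ k u ε, 0 < ε → ∃ d ∈ Set.Icc δ η, |F k (u + d) - F k u| ≤ ε := by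
  obtain ⟨δ, hδ0, hδ⟩ := exists_primes_log_sub_mem_Icc K hη
  refine ⟨δ, hδ0, fun k u ε hε ↦ ?_⟩
  set τ := ε / (4 * (A + 1)) with hτ
  have hτ0 : 0 < τ := by positivity
  have hAτ : A * τ ≤ ε / 4 := by
    have : (A + 1) * τ = ε / 4 := by rw [hτ]; field_simp
    nlinarith
  -- The shift `d` depends on the primes, which must avoid the exceptional sets of all `u + n * τ`
  -- on a grid; `u + d` is then replaced by a nearby grid point.
  obtain ⟨v, w, hv, hw, hvw⟩ := hδ _ (isThin_biUnion (Finset.range (⌊η / τ⌋₊ + 1))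
    (E := fun n : ℕ ↦ {v : HeightOneSpectrum (𝓞 K) | ε / 4 ≤
      |F (k + 1) (u + n * τ - Real.log (primeNorm v)) - F k (u + n * τ)|})
    fun n _ ↦ hthin k _ _ (by positivity))
  set d := Real.log (primeNorm w) - Real.log (primeNorm v) with hd
  have hd0 : 0 ≤ d := hδ0.le.trans hvw.1
  simp only [Set.mem_iUnion, not_exists, Set.mem_ofPred_eq, not_le, Finset.mem_range] at hv hw
  have h0 := hv 0 (by omega)
  rw [Nat.cast_zero, zero_mul, add_zero] at h0
  set n := ⌊d / τ⌋₊
  have hn : n < ⌊η / τ⌋₊ + 1 := by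
    rw [Nat.lt_succ_iff]
    exact Nat.floor_le_floor (div_le_div_of_nonneg_right hvw.2 hτ0.le)
  have h1 := hw n hn
  have hn1 : n * τ ≤ d := by
    rw [← le_div_iff₀ hτ0]; exact Nat.floor_le (by positivity)
  have hn2 : d ≤ n * τ + τ := by
    have := (Nat.lt_floor_add_one (d / τ)).le
    rw [div_le_iff₀ hτ0] at this; linarith
  refine ⟨d, hvw, ?_⟩
  have h2 := hLip (k + 1) (u + n * τ - Real.log (primeNorm w)) (u - Real.log (primeNorm v))
  have h3 := hLip k (u + d) (u + n * τ)
  have e2 : |u + n * τ - Real.log (primeNorm w) - (u - Real.log (primeNorm v))| ≤ τ := by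
    rw [abs_le]; constructor <;> linarith
  have e3 : |u + d - (u + n * τ)| ≤ τ := by
    rw [abs_le]; constructor <;> linarith
  have h2' := (h2.trans (mul_le_mul_of_nonneg_left e2 hA)).trans hAτ
  have h3' := (h3.trans (mul_le_mul_of_nonneg_left e3 hA)).trans hAτ
  rw [abs_le] at h2' h3' ⊢
  rw [abs_lt] at h0 h1
  constructor <;> linarith

/-- A Lipschitz function that is approximately harmonic along most primes is constant. -/
theorem eq_of_isThin (K : Type*) [Field K] [NumberField K] {F : ℕ → ℝ → ℝ}
    {A : ℝ} (hA : 0 ≤ A) (hLip : ∀ k u w, |F k u - F k w| ≤ A * |u - w|)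
    (hthin : ∀ k u ε, 0 < ε → IsThin {v : HeightOneSpectrum (𝓞 K) |
      ε ≤ |F (k + 1) (u - Real.log (primeNorm v)) - F k u|}) (k l : ℕ) (u : ℝ) :
    F k u = F l u := by
  have hconst : ∀ k u w, u ≤ w → F k w = F k u := by
    intro k u w huw
    refine eq_of_abs_sub_nonpos (le_of_forall_pos_le_add fun r hr ↦ ?_)
    obtain ⟨δ, hδ0, hδ⟩ := exists_abs_translate_sub_le K hA hLip hthin
      (div_pos hr (by positivity : 0 < 2 * (A + 1)))
    set η := r / (2 * (A + 1)) with hη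
    have hη0 : 0 < η := by positivity
    have hAη : A * η ≤ r / 2 := by
      have : (A + 1) * η = r / 2 := by rw [hη]; field_simp
      nlinarith
    -- Approximate periods of size at least `δ` lead from `u` to within `η` of `w` in a number of
    -- steps that does not depend on `ε`.
    have hchain : ∀ ε, 0 < ε → ∀ n : ℕ, ∀ u, u ≤ w → w - u ≤ n * δ →
        |F k w - F k u| ≤ n * ε + A * η := by
      intro ε hε n
      induction n with
      | zero =>
        intro u h1 h2
        rw [Nat.cast_zero, zero_mul] at h2
        have : u = w := by linarith
        rw [this, sub_self, abs_zero]; positivity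
      | succ n ih =>
        intro u h1 h2
        rcases le_or_gt (w - u) η with h | h
        · have h3 := hLip k w u
          rw [abs_of_nonneg (by linarith : 0 ≤ w - u)] at h3
          have h4 := mul_le_mul_of_nonneg_left h hA
          have h5 : 0 ≤ ((n + 1 : ℕ) : ℝ) * ε := by positivity
          linarith
        · obtain ⟨d, hd, hdF⟩ := hδ k u ε hε
          have h3 := ih (u + d) (by linarith [hd.2]) (by push_cast at h2; linarith [hd.1])
          have h4 : |F k w - F k u| ≤ |F k w - F k (u + d)| + |F k (u + d) - F k u| :=
            abs_sub_le _ _ _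
          push_cast
          linarith
    obtain ⟨n, hn⟩ := exists_nat_ge ((w - u) / δ)
    rw [div_le_iff₀ hδ0] at hn
    have h := hchain (r / (2 * (n + 1))) (by positivity) n u huw hn
    have h2 : n * (r / (2 * (n + 1))) ≤ r / 2 := by
      rw [mul_div_assoc', div_le_div_iff₀ (by positivity) (by positivity)]
      nlinarith
    linarith
  have hconst' : ∀ k u w, F k w = F k u := fun k u w ↦
    (le_total u w).elim (hconst k u w) fun h ↦ (hconst k w u h).symm
  have hstep : ∀ k, F (k + 1) u = F k u := by
    intro k
    refine eq_of_abs_sub_nonpos (le_of_forall_pos_le_add fun ε hε ↦ ?_)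
    obtain ⟨δ, -, hδ⟩ := exists_primes_log_sub_mem_Icc K one_pos
    obtain ⟨v, -, hv, -⟩ := hδ _ (hthin k u ε hε)
    rw [Set.mem_ofPred_eq, not_le, hconst' (k + 1) u] at hv
    linarith
  have h0 : ∀ k, F k u = F 0 u := by
    intro k
    induction k with
    | zero => rfl
    | succ k ih => rw [hstep, ih]
  rw [h0 k, h0 l]

theorem invNormSum_nonneg {K : Type*} [Field K] [NumberField K]
    (B : Finset (HeightOneSpectrum (𝓞 K))) : 0 ≤ invNormSum B :=
  Finset.sum_nonneg fun v _ ↦ one_div_nonneg.2 (primeNorm_pos v).le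

/-- If averages of `f` over finite sets `B` of primes are within `c / √(∑_{𝔭 ∈ B} 1 / N(𝔭))` of
`a`, then `f` is close to `a` off a thin set: apply the hypothesis to sets on which `f - a` has
constant sign. -/
theorem isThin_of_abs_sum_sub_le {K : Type*} [Field K] [NumberField K] {c : ℝ}
    {f : HeightOneSpectrum (𝓞 K) → ℝ} {a : ℝ}
    (h : ∀ B : Finset (HeightOneSpectrum (𝓞 K)),
      |∑ v ∈ B, f v / primeNorm v - invNormSum B * a| ≤ c * √(invNormSum B))
    {ε : ℝ} (hε : 0 < ε) : IsThin {v | ε ≤ |f v - a|} := by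
  have key : ∀ B : Finset (HeightOneSpectrum (𝓞 K)),
      ε * invNormSum B ≤ |∑ v ∈ B, f v / primeNorm v - invNormSum B * a| →
      invNormSum B ≤ (c / ε) ^ 2 := by
    intro B hB
    have h1 := hB.trans (h B)
    have h2 := Real.mul_self_sqrt (invNormSum_nonneg B)
    rcases (Real.sqrt_nonneg (invNormSum B)).eq_or_lt with h0 | h0
    · rw [← h0, mul_zero] at h2
      rw [← h2]; positivity
    · have h3 : √(invNormSum B) ≤ c / ε := by
        rw [le_div_iff₀ hε]
        refine le_of_mul_le_mul_right ?_ h0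
        calc _ = ε * (√(invNormSum B) * √(invNormSum B)) := by ring
          _ ≤ _ := by rw [h2]; exact h1
      calc invNormSum B = √(invNormSum B) ^ 2 := by rw [sq, h2]
        _ ≤ _ := by gcongr
  have hdiff : ∀ B : Finset (HeightOneSpectrum (𝓞 K)),
      ∑ v ∈ B, f v / primeNorm v - invNormSum B * a = ∑ v ∈ B, (f v - a) * (1 / primeNorm v) := by
    intro B
    rw [invNormSum, Finset.sum_mul, ← Finset.sum_sub_distrib]
    exact Finset.sum_congr rfl fun v _ ↦ by ring
  have hpos : IsThin {v | ε ≤ f v - a} := by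
    refine ⟨(c / ε) ^ 2, fun B hB ↦ key B ?_⟩
    refine le_trans ?_ (le_abs_self _)
    rw [hdiff, invNormSum, Finset.mul_sum]
    exact Finset.sum_le_sum fun v hv ↦
      mul_le_mul_of_nonneg_right (hB v hv) (one_div_nonneg.2 (primeNorm_pos v).le)
  have hneg : IsThin {v | ε ≤ -(f v - a)} := by
    refine ⟨(c / ε) ^ 2, fun B hB ↦ key B ?_⟩
    refine le_trans ?_ (neg_le_abs _)
    rw [hdiff, invNormSum, Finset.mul_sum, ← Finset.sum_neg_distrib]
    refine Finset.sum_le_sum fun v hv ↦ ?_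
    rw [← neg_mul]
    exact mul_le_mul_of_nonneg_right (hB v hv) (one_div_nonneg.2 (primeNorm_pos v).le)
  exact (hpos.union hneg).mono fun v hv ↦
    (le_abs.1 (show ε ≤ |f v - a| from hv)).imp id id

theorem abs_sum_le_card {K : Type*} [Field K] [NumberField K] {g : ℕ → ℝ}
    (hg : ∀ n, |g n| ≤ 1) (k : ℕ) (s : Finset (Ideal (𝓞 K))) :
    |∑ I ∈ s, g (idealOmega I + k)| ≤ s.card := by
  refine (Finset.abs_sum_le_sum_abs _ _).trans ?_
  calc _ ≤ ∑ I ∈ s, (1 : ℝ) := Finset.sum_le_sum fun I _ ↦ hg _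
    _ = _ := by simp

/-! ### Asymptotic translation invariance of `Ω` -/

/-- The normalized sum of `g (Ω(𝔪) + k)` over the ideals of norm at most `x * exp u`. -/
noncomputable def scaledSum (K : Type*) [Field K] [NumberField K] (g : ℕ → ℝ) (x : ℝ) (k : ℕ)
    (u : ℝ) : ℝ :=
  (∑ I ∈ idealsUpTo K (x * Real.exp u), g (idealOmega I + k)) / (x * Real.exp u)

theorem abs_scaledSum_sub_le {K : Type*} [Field K] [NumberField K] {g : ℕ → ℝ}
    (hg : ∀ n, |g n| ≤ 1) {x : ℝ} (hx : 0 < x) (k : ℕ) {u w : ℝ} (h : u ≤ w) :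
    |scaledSum K g x k w - scaledSum K g x k u| ≤
      ((idealsUpTo K (x * Real.exp w)).card : ℝ) / (x * Real.exp w) +
      ((idealsUpTo K (x * Real.exp u)).card : ℝ) / (x * Real.exp u) *
        (1 - 2 * Real.exp (u - w)) := by
  classical
  have hmono : x * Real.exp u ≤ x * Real.exp w := by gcongr
  have hsub := idealsUpTo_mono K hmono
  have hyw : 0 < x * Real.exp w := by positivity
  have hyu : 0 < x * Real.exp u := by positivity
  have h1 := abs_sum_le_card hg k (idealsUpTo K (x * Real.exp w) \ idealsUpTo K (x * Real.exp u))
  have h2 := abs_sum_le_card hg k (idealsUpTo K (x * Real.exp u))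
  rw [Finset.cast_card_sdiff hsub] at h1
  have h3 := Finset.sum_sdiff hsub (f := fun I ↦ g (idealOmega I + k))
  have he : Real.exp (u - w) ≤ 1 := by rw [Real.exp_le_one_iff]; linarith
  unfold scaledSum
  rw [← h3]
  set S := ∑ I ∈ idealsUpTo K (x * Real.exp u), g (idealOmega I + k)
  set D := ∑ I ∈ idealsUpTo K (x * Real.exp w) \ idealsUpTo K (x * Real.exp u),
    g (idealOmega I + k)
  set Nw := ((idealsUpTo K (x * Real.exp w)).card : ℝ)
  set Nu := ((idealsUpTo K (x * Real.exp u)).card : ℝ)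
  have hq : 1 / (x * Real.exp w) = 1 / (x * Real.exp u) * Real.exp (u - w) := by
    rw [Real.exp_sub]; field_simp
  calc |(D + S) / (x * Real.exp w) - S / (x * Real.exp u)|
      = |D / (x * Real.exp w) - S / (x * Real.exp u) * (1 - Real.exp (u - w))| := by
        congr 1
        rw [add_div, div_eq_mul_one_div S (x * Real.exp w), hq]
        ring
    _ ≤ |D| / (x * Real.exp w) + |S| / (x * Real.exp u) * (1 - Real.exp (u - w)) := by
        refine (abs_sub _ _).trans ?_
        rw [abs_div D, abs_mul (S / _), abs_div S, abs_of_pos hyw, abs_of_pos hyu,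
          abs_of_nonneg (by linarith : 0 ≤ 1 - Real.exp (u - w))]
    _ ≤ (Nw - Nu) / (x * Real.exp w) + Nu / (x * Real.exp u) * (1 - Real.exp (u - w)) := by
        have : 0 ≤ 1 - Real.exp (u - w) := by linarith
        gcongr
    _ = _ := by
        rw [sub_div, div_eq_mul_one_div Nu (x * Real.exp w), hq]
        ring

open Filter Topology in
/-- The distribution of `Ω` over the ideals of norm at most `x` is asymptotically invariant under
translations, uniformly in the test function. -/
theorem abs_sum_shift_sub_le (K : Type*) [Field K] [NumberField K] (k₁ k₂ : ℕ) {ε : ℝ}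
    (hε : 0 < ε) :
    ∃ X : ℝ, ∀ x ≥ X, ∀ g : ℕ → ℝ, (∀ n, |g n| ≤ 1) →
      |(∑ I ∈ idealsUpTo K x, g (idealOmega I + k₁)) -
        ∑ I ∈ idealsUpTo K x, g (idealOmega I + k₂)| ≤ ε * x := by
  by_contra! hcon
  choose x hx g hg hgx using fun n : ℕ ↦ hcon ((n : ℝ) + 1)
  have hx0 : ∀ n, 0 < x n := fun n ↦ lt_of_lt_of_le (by positivity) (hx n)
  have hxtop : Tendsto x atTop atTop :=
    tendsto_atTop_mono (fun n ↦ (le_add_of_nonneg_right zero_le_one).trans (hx n))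
      tendsto_natCast_atTop_atTop
  obtain ⟨c, hc0, hc⟩ := exists_tendsto_card_idealsUpTo_div K
  obtain ⟨C, hC0, hC⟩ := exists_card_idealsUpTo_le K
  set 𝒰 : Ultrafilter ℕ := hyperfilter ℕ
  have h𝒰 : (𝒰 : Filter ℕ) ≤ atTop := Nat.hyperfilter_le_atTop
  have hy : ∀ u : ℝ, Tendsto (fun n ↦ x n * Real.exp u) 𝒰 atTop := fun u ↦
    (hxtop.atTop_mul_const (Real.exp_pos u)).mono_left h𝒰
  -- The limits along an ultrafilter exist by compactness.
  have hlim : ∀ k u, ∃ l, Tendsto (fun n ↦ scaledSum K (g n) (x n) k u) 𝒰 (𝓝 l) := by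
    intro k u
    have hmem : ∀ n, scaledSum K (g n) (x n) k u ∈ Set.Icc (-C) C := by
      intro n
      have hp : 0 < x n * Real.exp u := mul_pos (hx0 n) (Real.exp_pos u)
      rw [Set.mem_Icc, ← abs_le, scaledSum, abs_div, abs_of_pos hp, div_le_iff₀ hp]
      exact (abs_sum_le_card (hg n) k _).trans (hC _ hp.le)
    obtain ⟨l, -, hl⟩ := (isCompact_Icc (a := -C) (b := C)).ultrafilter_le_nhds
      (𝒰.map fun n ↦ scaledSum K (g n) (x n) k u)
      (le_principal_iff.2 (Filter.mem_map.2 (Filter.univ_mem' hmem)))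
    exact ⟨l, hl⟩
  choose F hF using hlim
  have hLip' : ∀ k u w, u ≤ w → |F k w - F k u| ≤ 2 * c * (w - u) := by
    intro k u w huw
    have h1 : Tendsto (fun n ↦ |scaledSum K (g n) (x n) k w - scaledSum K (g n) (x n) k u|) 𝒰
      (𝓝 |F k w - F k u|) := ((hF k w).sub (hF k u)).abs
    have h2 := (hc.comp (hy w)).add ((hc.comp (hy u)).mul_const (1 - 2 * Real.exp (u - w)))
    have h3 := le_of_tendsto_of_tendsto' h1 h2 fun n ↦ abs_scaledSum_sub_le (hg n) (hx0 n) k huw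
    have h4 := Real.add_one_le_exp (u - w)
    nlinarith
  have hLip : ∀ k u w, |F k u - F k w| ≤ 2 * c * |u - w| := by
    intro k u w
    rcases le_total u w with h | h
    · rw [abs_sub_comm, abs_sub_comm u, abs_of_nonneg (sub_nonneg.2 h)]
      exact hLip' k u w h
    · rw [abs_of_nonneg (sub_nonneg.2 h)]
      exact hLip' k w u h
  have hTK : ∀ k u (B : Finset (HeightOneSpectrum (𝓞 K))),
      |∑ v ∈ B, F (k + 1) (u - Real.log (primeNorm v)) / primeNorm v - invNormSum B * F k u| ≤
        c * √(invNormSum B) := by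
    intro k u B
    have h1 : Tendsto (fun n ↦
        |∑ v ∈ B, scaledSum K (g n) (x n) (k + 1) (u - Real.log (primeNorm v)) / primeNorm v -
          invNormSum B * scaledSum K (g n) (x n) k u|) 𝒰
        (𝓝 |∑ v ∈ B, F (k + 1) (u - Real.log (primeNorm v)) / primeNorm v -
          invNormSum B * F k u|) :=
      ((tendsto_finsetSum _ fun v _ ↦ (hF (k + 1) _).div_const _).sub
        ((hF k u).const_mul _)).abs
    have h2 := (((hc.comp (hy u)).mul
      ((tendsto_turanKubiliusMoment_div hc B).comp (hy u)))).sqrt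
    have h3 := le_of_tendsto_of_tendsto' h1 h2 fun n ↦ by
      have hp : 0 < x n * Real.exp u := mul_pos (hx0 n) (Real.exp_pos u)
      have h := abs_sum_sum_sub_le B (x n * Real.exp u) (fun m ↦ g n (m + k)) fun m ↦ hg n _
      simp only [Function.comp]
      rw [div_mul_div_comm, Real.sqrt_div' _ (by positivity), Real.sqrt_mul_self hp.le,
        le_div_iff₀ hp, ← abs_of_pos hp, ← abs_mul, abs_of_pos hp]
      refine le_trans (le_of_eq ?_) h
      congr 1
      rw [sub_mul, Finset.sum_mul]
      congr 1
      · refine Finset.sum_congr rfl fun v _ ↦ ?_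
        have hv := primeNorm_pos v
        rw [scaledSum, Real.exp_sub, Real.exp_log hv, mul_div_assoc']
        rw [div_div, div_mul_cancel₀ _ hv.ne', div_mul_cancel₀ _ hp.ne']
        refine Finset.sum_congr rfl fun I _ ↦ ?_
        congr 1; omega
      · rw [scaledSum, mul_assoc, div_mul_cancel₀ _ hp.ne']
    refine h3.trans ?_
    calc √(c * (c * (invNormSum B - ∑ v ∈ B, (1 / primeNorm v) ^ 2)))
        ≤ √(c ^ 2 * invNormSum B) := by
          refine Real.sqrt_le_sqrt ?_
          have : 0 ≤ ∑ v ∈ B, (1 / primeNorm v) ^ 2 := Finset.sum_nonneg fun v _ ↦ sq_nonneg _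
          have h0 := mul_nonneg (sq_nonneg c) this
          linarith
      _ = c * √(invNormSum B) := by rw [Real.sqrt_mul (sq_nonneg c), Real.sqrt_sq hc0.le]
  have heq := eq_of_isThin K (by positivity : 0 ≤ 2 * c) hLip
    (fun k u ε hε ↦ isThin_of_abs_sum_sub_le (hTK k u) hε) k₁ k₂ 0
  have h1 : Tendsto (fun n ↦ |scaledSum K (g n) (x n) k₁ 0 - scaledSum K (g n) (x n) k₂ 0|) 𝒰
      (𝓝 |F k₁ 0 - F k₂ 0|) := ((hF k₁ 0).sub (hF k₂ 0)).abs
  have h2 : ε ≤ |F k₁ 0 - F k₂ 0| := ge_of_tendsto' h1 fun n ↦ by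
    rw [scaledSum, scaledSum, ← sub_div, Real.exp_zero, mul_one, abs_div, abs_of_pos (hx0 n),
      le_div_iff₀ (hx0 n)]
    exact (hgx n).le
  rw [heq, sub_self, abs_zero] at h2
  linarith

/-! ### Consequences of translation invariance -/

open Filter Topology in
/-- The error function is the supremum over all complex test functions; it is `o` of the number of
ideals by uniformity, applied to real and imaginary parts. -/
theorem exists_uniform_error (K : Type*) [Field K] [NumberField K] (k₁ k₂ : ℕ) :
    ∃ E : ℝ → ℝ, E =o[atTop] (fun x : ℝ => ((idealsUpTo K x).card : ℝ)) ∧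
      ∀ g : ℕ → ℂ, (∀ n, ‖g n‖ ≤ 1) → ∀ x : ℝ,
        ‖(∑ I ∈ idealsUpTo K x, g (idealOmega I + k₁)) -
          ∑ I ∈ idealsUpTo K x, g (idealOmega I + k₂)‖ ≤ E x := by
  set S : ℝ → Set ℝ := fun x ↦ {r | ∃ g : ℕ → ℂ, (∀ n, ‖g n‖ ≤ 1) ∧
    r = ‖(∑ I ∈ idealsUpTo K x, g (idealOmega I + k₁)) -
      ∑ I ∈ idealsUpTo K x, g (idealOmega I + k₂)‖} with hS
  have hne : ∀ x, (S x).Nonempty := fun x ↦ ⟨_, 0, by simp, rfl⟩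
  have hbdd : ∀ x, BddAbove (S x) := by
    intro x
    refine ⟨(idealsUpTo K x).card + (idealsUpTo K x).card, ?_⟩
    rintro _ ⟨g, hg, rfl⟩
    have h : ∀ k, ‖∑ I ∈ idealsUpTo K x, g (idealOmega I + k)‖ ≤ (idealsUpTo K x).card := by
      intro k
      refine (norm_sum_le _ _).trans ?_
      calc _ ≤ ∑ I ∈ idealsUpTo K x, (1 : ℝ) := Finset.sum_le_sum fun I _ ↦ hg _
        _ = _ := by simp
    exact (norm_sub_le _ _).trans (add_le_add (h _) (h _))
  refine ⟨fun x ↦ sSup (S x), ?_, fun g hg x ↦ le_csSup (hbdd x) ⟨g, hg, rfl⟩⟩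
  obtain ⟨c, hc0, hc⟩ := exists_tendsto_card_idealsUpTo_div K
  rw [Asymptotics.isLittleO_iff]
  intro ε hε
  obtain ⟨X, hX⟩ := abs_sum_shift_sub_le K k₁ k₂ (by positivity : 0 < ε * c / 4)
  filter_upwards [eventually_ge_atTop X, eventually_gt_atTop 0,
    hc.eventually_const_le (half_lt_self hc0)] with x hxX hx0 hxc
  rw [le_div_iff₀ hx0] at hxc
  have h0 : 0 ≤ sSup (S x) := by
    obtain ⟨r, hr⟩ := hne x
    refine le_trans ?_ (le_csSup (hbdd x) hr)
    obtain ⟨g, -, rfl⟩ := hr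
    exact norm_nonneg _
  rw [Real.norm_of_nonneg h0, Real.norm_of_nonneg (Nat.cast_nonneg _)]
  refine csSup_le (hne x) ?_
  rintro _ ⟨g, hg, rfl⟩
  have hre := hX x hxX (fun n ↦ (g n).re) fun n ↦ (Complex.abs_re_le_norm _).trans (hg n)
  have him := hX x hxX (fun n ↦ (g n).im) fun n ↦ (Complex.abs_im_le_norm _).trans (hg n)
  refine (Complex.norm_le_abs_re_add_abs_im _).trans ?_
  rw [Complex.sub_re, Complex.sub_im, Complex.re_sum, Complex.re_sum, Complex.im_sum,
    Complex.im_sum]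
  have := mul_le_mul_of_nonneg_left hxc hε.le
  linarith

open Filter Topology in
theorem isLittleO_sum_neg_one_pow (K : Type*) [Field K] [NumberField K] :
    (fun x : ℝ => ∑ I ∈ idealsUpTo K x, (-1 : ℝ) ^ idealOmega I) =o[atTop] (fun x : ℝ => x) := by
  rw [Asymptotics.isLittleO_iff]
  intro ε hε
  obtain ⟨X, hX⟩ := abs_sum_shift_sub_le K 0 1 hε
  filter_upwards [eventually_ge_atTop X, eventually_gt_atTop 0] with x hxX hx0
  have h := hX x hxX (fun n ↦ (-1) ^ n) fun n ↦ by simp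
  have e : (∑ I ∈ idealsUpTo K x, (-1 : ℝ) ^ (idealOmega I + 0)) -
      ∑ I ∈ idealsUpTo K x, (-1 : ℝ) ^ (idealOmega I + 1) =
      2 * ∑ I ∈ idealsUpTo K x, (-1 : ℝ) ^ idealOmega I := by
    simp_rw [pow_succ, add_zero, mul_neg_one, Finset.sum_neg_distrib]
    ring
  rw [e, abs_mul, abs_two] at h
  rw [Real.norm_eq_abs, Real.norm_of_nonneg hx0.le]
  have := abs_nonneg (∑ I ∈ idealsUpTo K x, (-1 : ℝ) ^ idealOmega I)
  linarith

/-- The mean value of `g (Ω(𝔪))` over the ideals of norm at most `x`. -/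
noncomputable def omegaMean (K : Type*) [Field K] [NumberField K] (g : ℕ → ℝ) (x : ℝ) : ℝ :=
  (∑ I ∈ idealsUpTo K x, g (idealOmega I)) / ((idealsUpTo K x).card : ℝ)

open Classical in
theorem omegaProportion_eq_omegaMean (K : Type*) [Field K] [NumberField K] (P : ℕ → Prop) (x : ℝ) :
    omegaProportion K P x = omegaMean K (fun n ↦ if P n then 1 else 0) x := by
  simp [omegaProportion, omegaMean]

theorem eventually_card_idealsUpTo_pos (K : Type*) [Field K] [NumberField K] :
    ∀ᶠ x : ℝ in Filter.atTop, (0 : ℝ) < (idealsUpTo K x).card := by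
  filter_upwards [Filter.eventually_ge_atTop 1] with x hx
  rw [Nat.cast_pos, Finset.card_pos]
  exact ⟨⊤, mem_idealsUpTo.2 ⟨top_ne_bot, by simpa using hx⟩⟩

open Filter Topology in
theorem tendsto_omegaMean_shift_sub (K : Type*) [Field K] [NumberField K] {g : ℕ → ℝ}
    (hg : ∀ n, |g n| ≤ 1) (k₁ k₂ : ℕ) :
    Tendsto (fun x ↦ omegaMean K (fun n ↦ g (n + k₁)) x - omegaMean K (fun n ↦ g (n + k₂)) x)
      atTop (𝓝 0) := by
  obtain ⟨E, hE, hgE⟩ := exists_uniform_error K k₁ k₂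
  refine squeeze_zero_norm' ?_ hE.tendsto_div_nhds_zero
  filter_upwards [eventually_card_idealsUpTo_pos K] with x hx
  rw [omegaMean, omegaMean, ← sub_div, norm_div, Real.norm_of_nonneg hx.le]
  gcongr
  have := hgE (fun n ↦ (g n : ℂ)) (fun n ↦ by simpa using hg n) x
  simpa [← Complex.ofReal_sum, ← Complex.ofReal_sub] using this

theorem sum_range_ite_modEq {q : ℕ} (hq : 1 ≤ q) (c n : ℕ) :
    ∑ j ∈ Finset.range q, (if n + j ≡ c [MOD q] then (1 : ℝ) else 0) = 1 := by
  have : NeZero q := ⟨by omega⟩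
  rw [Finset.sum_eq_single_of_mem ((c - n : ZMod q).val)
    (Finset.mem_range.2 (ZMod.val_lt _))]
  · rw [if_pos]
    rw [← ZMod.natCast_eq_natCast_iff]
    simp
  · intro j hj hne
    rw [if_neg]
    rw [← ZMod.natCast_eq_natCast_iff]
    intro h
    apply hne
    push_cast at h
    rw [← eq_sub_iff_add_eq'.2 h, ZMod.val_natCast, Nat.mod_eq_of_lt (Finset.mem_range.1 hj)]

open Filter Topology in
theorem tendsto_omegaProportion_modEq (K : Type*) [Field K] [NumberField K] {q : ℕ} (hq : 1 ≤ q)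
    (c : ℕ) :
    Tendsto (omegaProportion K (fun n => n ≡ c [MOD q])) atTop (𝓝 (1 / (q : ℝ))) := by
  classical
  have hq0 : (0 : ℝ) < q := by exact_mod_cast hq
  set g : ℕ → ℝ := fun n ↦ if n ≡ c [MOD q] then 1 else 0 with hg
  have hg1 : ∀ n, |g n| ≤ 1 := fun n ↦ by simp only [hg]; split_ifs <;> simp
  have h1 : Tendsto (fun x ↦ ∑ j ∈ Finset.range q,
      (omegaMean K (fun n ↦ g (n + 0)) x - omegaMean K (fun n ↦ g (n + j)) x)) atTop (𝓝 0) := by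
    have := tendsto_finsetSum (Finset.range q) fun j _ ↦ tendsto_omegaMean_shift_sub K hg1 0 j
    simpa using this
  have h2 := (h1.add_const 1).div_const (q : ℝ)
  rw [zero_add] at h2
  refine h2.congr' ?_
  filter_upwards [eventually_card_idealsUpTo_pos K] with x hx
  have h3 : ∑ j ∈ Finset.range q, omegaMean K (fun n ↦ g (n + j)) x = 1 := by
    simp only [omegaMean]
    rw [← Finset.sum_div, Finset.sum_comm, Finset.sum_congr rfl fun I _ ↦
      sum_range_ite_modEq hq c (idealOmega I)]
    simp [hx.ne']
  rw [Finset.sum_sub_distrib, h3, omegaProportion_eq_omegaMean]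
  simp only [add_zero, Finset.sum_const, Finset.card_range, nsmul_eq_mul, sub_add_cancel]
  rw [mul_div_cancel_left₀ _ hq0.ne']
  congr!

/-- The indicator of an interval modulo 1 in terms of translates of the sawtooth function. -/
theorem ite_fract_mem_Ico {a b : ℝ} (ha : 0 ≤ a) (hab : a ≤ b) (hb : b ≤ 1) (t : ℝ)
    [Decidable (Int.fract t ∈ Set.Ico a b)] :
    (if Int.fract t ∈ Set.Ico a b then (1 : ℝ) else 0) =
      (b - a) + (Int.fract (t - b) - Int.fract (t - a)) := by
  have h0 := Int.fract_nonneg t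
  have h1 := Int.fract_lt_one t
  have key : ∀ d : ℝ, 0 ≤ d → d ≤ 1 → Int.fract (t - d) =
      if Int.fract t < d then Int.fract t - d + 1 else Int.fract t - d := by
    intro d hd0 hd1
    split_ifs with h
    · rw [Int.fract_eq_iff]
      refine ⟨by linarith, by linarith, ⌊t⌋ - 1, ?_⟩
      have := Int.floor_add_fract t
      push_cast; linarith
    · rw [Int.fract_eq_iff]
      refine ⟨by linarith, by linarith, ⌊t⌋, ?_⟩
      have := Int.floor_add_fract t
      linarith
  rw [key a ha (hab.trans hb), key b (ha.trans hab) hb]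
  simp only [Set.mem_Ico]
  split_ifs <;> grind

/-- As `d` increases, `Int.fract (t - d)` decreases at unit speed and jumps only upwards. -/
theorem fract_sub_le_fract_sub_add {d e : ℝ} (h : d ≤ e) (t : ℝ) :
    Int.fract (t - d) ≤ Int.fract (t - e) + (e - d) := by
  have h1 := Int.floor_add_fract (t - d)
  have h2 := Int.floor_add_fract (t - e)
  have h3 : (⌊t - e⌋ : ℝ) ≤ ⌊t - d⌋ := by
    exact_mod_cast Int.floor_le_floor (by linarith : t - e ≤ t - d)
  linarith

open Filter Topology in
/-- The mean of `Int.fract (α * Ω - a)` asymptotically does not depend on `a`: translating `Ω`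
changes `a` by a multiple of `α`, these are dense modulo 1, and the one-sided Lipschitz bound for
the sawtooth function bridges the remaining gap. -/
theorem eventually_omegaMean_fract_le (K : Type*) [Field K] [NumberField K] {α : ℝ}
    (hα : Irrational α) (a b : ℝ) {ε : ℝ} (hε : 0 < ε) :
    ∀ᶠ x in atTop, omegaMean K (fun n ↦ Int.fract (α * n - a)) x ≤
      omegaMean K (fun n ↦ Int.fract (α * n - b)) x + ε := by
  obtain ⟨y, hyd, hy⟩ := (dense_addSubgroupClosure_pair_iff.2
    (by simpa using hα : Irrational (α / 1))).exists_mem_open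
    (isOpen_Ioo (a := b - a - ε / 2) (b := b - a))
    ⟨b - a - ε / 4, by constructor <;> linarith⟩
  obtain ⟨m, l, rfl⟩ := AddSubgroup.mem_closure_pair.1 hyd
  simp only [zsmul_eq_mul, mul_one, Set.mem_Ioo] at hy
  have hm : (m : ℝ) = (m.toNat : ℝ) - ((-m).toNat : ℝ) := by
    exact_mod_cast (Int.toNat_sub_toNat_neg m).symm
  have h := tendsto_omegaMean_shift_sub K
    (g := fun n ↦ Int.fract (α * n - α * m.toNat - a))
    (fun n ↦ by rw [abs_of_nonneg (Int.fract_nonneg _)]; exact (Int.fract_lt_one _).le)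
    m.toNat (-m).toNat
  filter_upwards [h.eventually_le_const (half_pos hε), eventually_card_idealsUpTo_pos K]
    with x hx hx0
  have e1 : (fun n : ℕ ↦ Int.fract (α * (n + m.toNat : ℕ) - α * m.toNat - a)) =
      fun n : ℕ ↦ Int.fract (α * n - a) := by
    ext n; congr 1; push_cast; ring
  have e2 : (fun n : ℕ ↦ Int.fract (α * (n + (-m).toNat : ℕ) - α * m.toNat - a)) =
      fun n : ℕ ↦ Int.fract (α * n - (a + (m * α + l))) := by
    ext n
    rw [← Int.fract_sub_intCast _ l]
    congr 1; rw [hm]; push_cast; ring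
  rw [e1, e2] at hx
  have h2 : omegaMean K (fun n : ℕ ↦ Int.fract (α * n - (a + (m * α + l)))) x ≤
      omegaMean K (fun n : ℕ ↦ Int.fract (α * n - b)) x + ε / 2 := by
    rw [omegaMean, omegaMean, div_add' _ _ _ hx0.ne']
    gcongr
    rw [mul_comm (ε / 2), ← nsmul_eq_mul, ← Finset.sum_const, ← Finset.sum_add_distrib]
    refine Finset.sum_le_sum fun I _ ↦ ?_
    have := fract_sub_le_fract_sub_add (by linarith [hy.2] : a + (m * α + l) ≤ b)
      (α * idealOmega I)
    linarith [hy.1]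
  linarith

open Filter Topology in
theorem tendsto_omegaProportion_fract (K : Type*) [Field K] [NumberField K] {α : ℝ}
    (hα : Irrational α) {a b : ℝ} (ha : 0 ≤ a) (hab : a ≤ b) (hb : b ≤ 1) :
    Tendsto (omegaProportion K (fun n => Int.fract (α * (n : ℝ)) ∈ Set.Ico a b))
      atTop (𝓝 (b - a)) := by
  classical
  rw [Metric.tendsto_nhds]
  intro ε hε
  filter_upwards [eventually_omegaMean_fract_le K hα a b (half_pos hε),
    eventually_omegaMean_fract_le K hα b a (half_pos hε), eventually_card_idealsUpTo_pos K]
    with x h1 h2 hx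
  have h3 : omegaProportion K (fun n => Int.fract (α * (n : ℝ)) ∈ Set.Ico a b) x =
      (b - a) + (omegaMean K (fun n ↦ Int.fract (α * n - b)) x -
        omegaMean K (fun n ↦ Int.fract (α * n - a)) x) := by
    rw [omegaProportion_eq_omegaMean]
    simp only [omegaMean]
    rw [Finset.sum_congr rfl fun I _ ↦ @ite_fract_mem_Ico a b ha hab hb (α * idealOmega I)
        (Classical.propDecidable _)]
    simp only [Finset.sum_add_distrib, Finset.sum_sub_distrib, Finset.sum_const, nsmul_eq_mul]
    field_simp
  rw [h3, Real.dist_eq, add_sub_cancel_left, abs_lt]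
  constructor <;> linarith

theorem theorem1 (K : Type*) [Field K] [NumberField K] :
    -- the main assertion: the error is uniform in `g`
    (∃ N : ℕ, 0 < N ∧ ∀ k₁ k₂ : ℕ, N ≤ k₁ → N ≤ k₂ →
      ∃ E : ℝ → ℝ,
        E =o[Filter.atTop] (fun x : ℝ => ((idealsUpTo K x).card : ℝ)) ∧
        ∀ g : ℕ → ℂ, (∀ n, ‖g n‖ ≤ 1) → ∀ x : ℝ,
          ‖(∑ I ∈ idealsUpTo K x, g (idealOmega I + k₁)) -
            ∑ I ∈ idealsUpTo K x, g (idealOmega I + k₂)‖ ≤ E x) ∧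
    -- the summatory Liouville function is `o(x)`
    ((fun x : ℝ => ∑ I ∈ idealsUpTo K x, (-1 : ℝ) ^ idealOmega I)
      =o[Filter.atTop] (fun x : ℝ => x)) ∧
    -- `Ω` is equidistributed modulo every `q ≥ 1`
    (∀ q : ℕ, 1 ≤ q → ∀ c : ℕ,
      Filter.Tendsto (omegaProportion K (fun n => n ≡ c [MOD q])) Filter.atTop
        (nhds (1 / (q : ℝ)))) ∧
    -- `α Ω` is uniformly distributed modulo 1 for every irrational `α`
    (∀ α : ℝ, Irrational α → ∀ a b : ℝ, 0 ≤ a → a ≤ b → b ≤ 1 →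
      Filter.Tendsto (omegaProportion K (fun n => Int.fract (α * (n : ℝ)) ∈ Set.Ico a b))
        Filter.atTop (nhds (b - a))) :=
  ⟨⟨1, one_pos, fun k₁ k₂ _ _ ↦ exists_uniform_error K k₁ k₂⟩, isLittleO_sum_neg_one_pow K,
    fun _ hq c ↦ tendsto_omegaProportion_modEq K hq c,
    fun _ hα _ _ ha hab hb ↦ tendsto_omegaProportion_fract K hα ha hab hb⟩
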